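/- Let $R$ be a commutative ring. **Correspondences.** $\mathrm{Corresp}$ is the category whose objects are the finite sets, in which a morphism $X\to Y$ is a subset $U\subseteq Y\times X$, and in which the composite of $V\subseteq Y\times X$ and $U\subseteq Z\times Y$ is $UV=\{(z,x) : \exists y\in Y,\ (z,y)\in U \text{ and } (y,x)\in V\}$. Its $R$-linearization is $R\mathrm{Corresp}$. For a finite set $X$, put $$\mathrm{Ess}_{R\mathrm{Corresp}}(X)=\mathrm{End}_{R\mathrm{Corresp}}(X)/I(X),$$ where $I(X)$ is the two-sided ideal that is the $R$-span of the correspondences $X\to X$ that factor through some finite set $Z$ with $|Z|<|X|$. **Bisets.** For finite categories $\mathcal C,\mathcal D$, a (finite) $(\mathcal C,\mathcal D)$-biset is a functor $\Omega$ from $\mathcal C\times\mathcal D^{\mathrm{op}}$ to finite sets. The composite of a $(\mathcal C,\mathcal D)$-biset $\Omega$ and a $(\mathcal D,\mathcal E)$-biset $\Psi$ is $$(\Omega\circ\Psi)(x,z)=\Bigl(\bigsqcup_{y\in\mathcal D}\Omega(x,y)\times\Psi(y,z)\Bigr)\Big/\!\sim ,$$ where $\sim$ is the equivalence relation generated by $(u\beta,v)\sim(u,\beta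 v)$ for morphisms $\beta$ of $\mathcal D$. The biset $\Omega$ is *birepresentable* if the functor $x\mapsto\bigsqcup_{y}\Omega(x,y)$ on $\mathcal C$ is isomorphic to a disjoint union of representable functors $\mathrm{Hom}_{\mathcal C}(c,-)$, and the functor $y\mapsto\bigsqcup_{x}\Omega(x,y)$ on $\mathcal D^{\mathrm{op}}$ is isomorphic to a disjoint union of representable functors $\mathrm{Hom}_{\mathcal D}(-,d)$. The category $\mathbb B^{1,1}$ has the finite categories as objects, and $\mathrm{Hom}_{\mathbb B^{1,1}}(\mathcal D,\mathcal C)=R\otimes_{\mathbb Z}A^{1,1}(\mathcal C,\mathcal D)$, where $A^{1,1}(\mathcal C,\mathcal D)$ is the Grothendieck group, with respect to disjoint unions, of the isomorphism classes of birepresentable $(\mathcal C,\mathcal D)$-bisets; composition is the $R$-bilinear extension of $\circ$. For a finite set $X$ let $2^X$ be the poset of subsets of $X$ ordered by inclusion, regarded as a category. Put $$\mathrm{Ess}^{<}_{\mathbb B^{1,1}}(2^X)=\mathrm{End}_{\mathbb B^{1,1}}(2^X)/J(X),$$ where $J(X)$ is the two-sided ideal that is the $R$-span of the classes of the bisets $\Psi\circ\Theta$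 with $\Psi$ a birepresentable $(2^X,2^Z)$-biset and $\Theta$ a birepresentable $(2^Z,2^X)$-biset, for finite sets $Z$ with $|Z|<|X|$. For $U\subseteq Y\times X$ and $A\subseteq X$ let ${}^+U(A)=\{y\in Y : \exists x\in A,\ (y,x)\in U\}$, and let ${}_{2^Y}2^Y_{({}^+U)2^X}$ denote the $(2^Y,2^X)$-biset $(B,A)\mapsto \mathrm{Hom}_{2^Y}({}^+U(A),B)$; this biset is birepresentable. **Theorem.** The assignments $X\mapsto 2^X$ and $U\mapsto {}_{2^Y}2^Y_{({}^+U)2^X}$ (for $U\subseteq Y\times X$) define a functor $\mathrm{Corresp}\to\mathbb B^{1,1}$. For every finite set $X$, the $R$-linear extension $\mathrm{End}_{R\mathrm{Corresp}}(X)\to\mathrm{End}_{\mathbb B^{1,1}}(2^X)$ of this functor induces an isomorphism of $R$-algebras $$\mathrm{Ess}_{R\mathrm{Corresp}}(X)\;\cong\;\mathrm{Ess}^{<}_{\mathbb B^{1,1}}(2^X).$$ -/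

import Mathlib

open CategoryTheory Opposite

universe w u

namespace BisetCorr

/-! ### Bisets

A `(C, D)`-biset is a functor `C × Dᵒᵖ ⥤ Type`; we use its curried form, which is Mathlib's
`Profunctor C D = C ⥤ Dᵒᵖ ⥤ Type`. Finiteness of the values is imposed later, in `Biset11`. -/

section Bisets

variable {C D E F : Type u} [SmallCategory C] [SmallCategory D] [SmallCategory E]
  [SmallCategory F]

/-- The value of a biset at the pair `(x, y)`. -/
abbrev El (P : Profunctor.{u} C D) (x : C) (y : D) : Type u := (P.obj x).obj (op y)

/-- The left action `α u`. -/
def lact (P : Profunctor.{u} C D) {x x₁ : C} {y : D} (α : x ⟶ x₁) (u : El P x y) : El P x₁ y :=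
  (P.map α).app (op y) u

/-- The right action `u β`. -/
def ract (P : Profunctor.{u} C D) {x : C} {y y₁ : D} (u : El P x y) (β : y₁ ⟶ y) : El P x y₁ :=
  (P.obj x).map β.op u

section
variable (P : Profunctor.{u} C D)

@[simp] lemma lact_id {x : C} {y : D} (u : El P x y) : lact P (𝟙 x) u = u := by
  simp [lact]

@[simp] lemma ract_id {x : C} {y : D} (u : El P x y) : ract P u (𝟙 y) = u := by
  simp [ract]

lemma lact_comp {x x₁ x₂ : C} {y : D} (α : x ⟶ x₁) (β : x₁ ⟶ x₂) (u : El P x y) :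
    lact P (α ≫ β) u = lact P β (lact P α u) := by
  simp [lact]

lemma ract_comp {x : C} {y y₁ y₂ : D} (α : y₂ ⟶ y₁) (β : y₁ ⟶ y) (u : El P x y) :
    ract P u (α ≫ β) = ract P (ract P u β) α := by
  simp [ract]

lemma lact_ract {x x₁ : C} {y y₁ : D} (α : x ⟶ x₁) (u : El P x y) (β : y₁ ⟶ y) :
    lact P α (ract P u β) = ract P (lact P α u) β := by
  simp only [lact, ract]
  exact NatTrans.naturality_apply (P.map α) β.op u

end

/-- Build a biset from two commuting actions. -/
def ofActions (obj : C → D → Type u)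
    (l : ∀ {x x₁ : C} {y : D}, (x ⟶ x₁) → obj x y → obj x₁ y)
    (r : ∀ {x : C} {y y₁ : D}, obj x y → (y₁ ⟶ y) → obj x y₁)
    (l_id : ∀ {x : C} {y : D} (u : obj x y), l (𝟙 x) u = u)
    (r_id : ∀ {x : C} {y : D} (u : obj x y), r u (𝟙 y) = u)
    (l_comp : ∀ {x x₁ x₂ : C} {y : D} (α : x ⟶ x₁) (β : x₁ ⟶ x₂) (u : obj x y),
      l (α ≫ β) u = l β (l α u))
    (r_comp : ∀ {x : C} {y y₁ y₂ : D} (α : y₂ ⟶ y₁) (β : y₁ ⟶ y) (u : obj x y),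
      r u (α ≫ β) = r (r u β) α)
    (l_r : ∀ {x x₁ : C} {y y₁ : D} (α : x ⟶ x₁) (u : obj x y) (β : y₁ ⟶ y),
      l α (r u β) = r (l α u) β) : Profunctor.{u} C D where
  obj x :=
    { obj := fun y => obj x (unop y)
      map := fun β => ↾(fun u => r u β.unop)
      map_id := fun y => by ext u; exact r_id u
      map_comp := fun β γ => by ext u; exact r_comp γ.unop β.unop u }
  map α :=
    { app := fun y => ↾(fun u => l α u)
      naturality := fun y y₁ β => by ext u; exact l_r α u β.unop }
  map_id x := by ext y u; exact l_id u
  map_comp α β := by ext y u; exact l_comp α β u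

/-- Isomorphisms of bisets are the bijections that respect both actions. -/
lemma nonempty_iso_iff {P Q : Profunctor.{u} C D} :
    Nonempty (P ≅ Q) ↔ ∃ e : ∀ x y, El P x y ≃ El Q x y,
      (∀ {x x₁ : C} {y : D} (α : x ⟶ x₁) (u : El P x y),
        e x₁ y (lact P α u) = lact Q α (e x y u)) ∧
      (∀ {x : C} {y y₁ : D} (u : El P x y) (β : y₁ ⟶ y),
        e x y₁ (ract P u β) = ract Q (e x y u) β) := by
  constructor
  · rintro ⟨i⟩
    refine ⟨fun x y => ((i.app x).app (op y)).toEquiv, ?_, ?_⟩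
    · intro x x₁ y α u
      have := congrArg (fun f => NatTrans.app f (op y)) (i.hom.naturality α)
      exact ConcreteCategory.congr_hom this u
    · intro x y y₁ u β
      exact ConcreteCategory.congr_hom ((i.hom.app x).naturality β.op) u
  · rintro ⟨e, hl, hr⟩
    refine ⟨NatIso.ofComponents (fun x => NatIso.ofComponents
      (fun y => (e x (unop y)).toIso) ?_) ?_⟩
    · intro y y₁ β
      ext u
      exact hr (y := unop y) u β.unop
    · intro x x₁ α
      ext y u
      exact hl (y := unop y) α u

/-- The disjoint union of two bisets. -/
def sumBiset (P Q : Profunctor.{u} C D) : Profunctor.{u} C D :=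
  ofActions (fun x y => El P x y ⊕ El Q x y)
    (fun α => Sum.map (lact P α) (lact Q α))
    (fun u β => Sum.map (fun p => ract P p β) (fun q => ract Q q β) u)
    (by rintro x y (u | u) <;> simp)
    (by rintro x y (u | u) <;> simp)
    (by rintro x x₁ x₂ y α β (u | u) <;> simp [lact_comp])
    (by rintro x y y₁ y₂ α β (u | u) <;> simp [ract_comp])
    (by rintro x x₁ y y₁ α (u | u) β <;> simp [lact_ract])

/-- The empty biset. -/
def emptyBiset : Profunctor.{u} C D :=
  ofActions (fun _ _ => PEmpty) (fun _ u => u) (fun u _ => u)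
    (fun _ => rfl) (fun _ => rfl) (fun _ _ _ => rfl) (fun _ _ _ => rfl) (fun _ _ _ => rfl)

/-- The relation `(u β, v) ∼ (u, β v)` on the disjoint union over `y` of `P (x, y) × Q (y, z)`. -/
inductive CompRel (P : Profunctor.{u} C D) (Q : Profunctor.{u} D E) (x : C) (z : E) :
    (Σ y : D, El P x y × El Q y z) → (Σ y : D, El P x y × El Q y z) → Prop
  | mk {y₁ y₂ : D} (u : El P x y₁) (β : y₂ ⟶ y₁) (v : El Q y₂ z) :
      CompRel P Q x z ⟨y₂, ract P u β, v⟩ ⟨y₁, u, lact Q β v⟩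

/-- The values of the composite: the quotient by the equivalence relation that `CompRel`
generates. -/
def CompEl (P : Profunctor.{u} C D) (Q : Profunctor.{u} D E) (x : C) (z : E) : Type u :=
  Quot (CompRel P Q x z)

/-- The class of a pair `(u, v)`. -/
def CompEl.mk (P : Profunctor.{u} C D) (Q : Profunctor.{u} D E) {x : C} {y : D} {z : E}
    (u : El P x y) (v : El Q y z) : CompEl P Q x z :=
  Quot.mk _ ⟨y, u, v⟩

lemma CompEl.sound (P : Profunctor.{u} C D) (Q : Profunctor.{u} D E) {x : C} {y₁ y₂ : D} {z : E}
    (u : El P x y₁) (β : y₂ ⟶ y₁) (v : El Q y₂ z) :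
    CompEl.mk P Q (ract P u β) v = CompEl.mk P Q u (lact Q β v) :=
  Quot.sound (CompRel.mk u β v)

lemma CompEl.ind {P : Profunctor.{u} C D} {Q : Profunctor.{u} D E} {x : C} {z : E}
    {p : CompEl P Q x z → Prop}
    (h : ∀ (y : D) (u : El P x y) (v : El Q y z), p (CompEl.mk P Q u v)) (t) : p t := by
  obtain ⟨y, u, v⟩ := t
  exact h y u v

/-- Maps out of the composite. -/
def CompEl.lift {P : Profunctor.{u} C D} {Q : Profunctor.{u} D E} {x : C} {z : E} {T : Type u}
    (f : ∀ {y : D}, El P x y → El Q y z → T)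
    (h : ∀ {y₁ y₂ : D} (u : El P x y₁) (β : y₂ ⟶ y₁) (v : El Q y₂ z),
      f (ract P u β) v = f u (lact Q β v)) (t : CompEl P Q x z) : T :=
  Quot.lift (fun p => f p.2.1 p.2.2) (by rintro _ _ ⟨u, β, v⟩; exact h u β v) t

lemma CompEl.lift_mk {P : Profunctor.{u} C D} {Q : Profunctor.{u} D E} {x : C} {z : E}
    {T : Type u} (f : ∀ {y : D}, El P x y → El Q y z → T)
    (h : ∀ {y₁ y₂ : D} (u : El P x y₁) (β : y₂ ⟶ y₁) (v : El Q y₂ z),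
      f (ract P u β) v = f u (lact Q β v)) {y : D} (u : El P x y) (v : El Q y z) :
    CompEl.lift f h (CompEl.mk P Q u v) = f u v := rfl

/-- The composite `P ∘ Q` of bisets. -/
def compBiset (P : Profunctor.{u} C D) (Q : Profunctor.{u} D E) : Profunctor.{u} C E :=
  ofActions (CompEl P Q)
    (fun α => CompEl.lift (fun u v => CompEl.mk P Q (lact P α u) v)
      (fun u β v => by rw [lact_ract, CompEl.sound]))
    (fun t γ => CompEl.lift (fun u v => CompEl.mk P Q u (ract Q v γ))
      (fun u β v => by rw [CompEl.sound, lact_ract]) t)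
    (CompEl.ind fun y u v => by rw [CompEl.lift_mk, lact_id])
    (CompEl.ind fun y u v => by rw [CompEl.lift_mk, ract_id])
    (fun α β => CompEl.ind fun y u v =>
      congrArg (fun w => CompEl.mk P Q w v) (lact_comp P α β u))
    (fun α β => CompEl.ind fun y u v =>
      congrArg (fun w => CompEl.mk P Q u w) (ract_comp Q α β v))
    (fun α t β => by induction t using CompEl.ind; simp only [CompEl.lift_mk])

@[simp] lemma lact_compBiset (P : Profunctor.{u} C D) (Q : Profunctor.{u} D E) {x x₁ : C}
    {y : D} {z : E} (α : x ⟶ x₁) (u : El P x y) (v : El Q y z) :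
    lact (compBiset P Q) (y := z) α (CompEl.mk P Q u v) = CompEl.mk P Q (lact P α u) v := rfl

@[simp] lemma ract_compBiset (P : Profunctor.{u} C D) (Q : Profunctor.{u} D E) {x : C}
    {y : D} {z z₁ : E} (γ : z₁ ⟶ z) (u : El P x y) (v : El Q y z) :
    ract (compBiset P Q) (x := x) (CompEl.mk P Q u v) γ = CompEl.mk P Q u (ract Q v γ) := rfl

/-! ### Isomorphisms of composites -/

lemma compBiset_congr {P P' : Profunctor.{u} C D} {Q Q' : Profunctor.{u} D E}
    (hP : Nonempty (P ≅ P')) (hQ : Nonempty (Q ≅ Q')) :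
    Nonempty (compBiset P Q ≅ compBiset P' Q') := by
  rw [nonempty_iso_iff] at hP hQ ⊢
  obtain ⟨e, el, er⟩ := hP
  obtain ⟨f, fl, fr⟩ := hQ
  have el' : ∀ {x x₁ : C} {y : D} (α : x ⟶ x₁) (u : El P' x y),
      (e x₁ y).symm (lact P' α u) = lact P α ((e x y).symm u) := fun α u => by
    rw [Equiv.symm_apply_eq, el, Equiv.apply_symm_apply]
  have er' : ∀ {x : C} {y y₁ : D} (u : El P' x y) (β : y₁ ⟶ y),
      (e x y₁).symm (ract P' u β) = ract P ((e x y).symm u) β := fun u β => by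
    rw [Equiv.symm_apply_eq, er, Equiv.apply_symm_apply]
  have fl' : ∀ {x x₁ : D} {y : E} (α : x ⟶ x₁) (u : El Q' x y),
      (f x₁ y).symm (lact Q' α u) = lact Q α ((f x y).symm u) := fun α u => by
    rw [Equiv.symm_apply_eq, fl, Equiv.apply_symm_apply]
  refine ⟨fun x z =>
    { toFun := CompEl.lift (fun u v => CompEl.mk P' Q' (e _ _ u) (f _ _ v))
        (fun u β v => by rw [er, fl, CompEl.sound])
      invFun := CompEl.lift (fun u v => CompEl.mk P Q ((e _ _).symm u) ((f _ _).symm v))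
        (fun u β v => by rw [er', fl', CompEl.sound])
      left_inv := CompEl.ind fun y u v => congrArg₂ (fun a b => CompEl.mk P Q a b)
        ((e x y).symm_apply_apply u) ((f y z).symm_apply_apply v)
      right_inv := CompEl.ind fun y u v => congrArg₂ (fun a b => CompEl.mk P' Q' a b)
        ((e x y).apply_symm_apply u) ((f y z).apply_symm_apply v) }, ?_, ?_⟩
  · intro x x₁ z α t
    induction t using CompEl.ind with
    | h y u v => exact congrArg (fun w => CompEl.mk P' Q' w (f y z v)) (el α u)
  · intro x z z₁ t γ
    induction t using CompEl.ind with
    | h y u v => exact congrArg (fun w => CompEl.mk P' Q' (e x y u) w) (fr v γ)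

lemma compBiset_sum_left (P P' : Profunctor.{u} C D) (Q : Profunctor.{u} D E) :
    Nonempty (compBiset (sumBiset P P') Q ≅ sumBiset (compBiset P Q) (compBiset P' Q)) := by
  rw [nonempty_iso_iff]
  refine ⟨fun x z =>
    { toFun := CompEl.lift (P := sumBiset P P')
        (T := El (compBiset P Q) x z ⊕ El (compBiset P' Q) x z) (fun u v => Sum.map
        (fun p => CompEl.mk P Q p v) (fun p => CompEl.mk P' Q p v) u) ?_
      invFun := Sum.elim
        (CompEl.lift (fun u v => CompEl.mk (sumBiset P P') Q (Sum.inl u) v)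
          (fun u β v => CompEl.sound (sumBiset P P') Q (Sum.inl u) β v))
        (CompEl.lift (fun u v => CompEl.mk (sumBiset P P') Q (Sum.inr u) v)
          (fun u β v => CompEl.sound (sumBiset P P') Q (Sum.inr u) β v))
      left_inv := ?_
      right_inv := ?_ }, ?_, ?_⟩
  · rintro y₁ y₂ (u | u) β v
    · exact congrArg Sum.inl (CompEl.sound P Q u β v)
    · exact congrArg Sum.inr (CompEl.sound P' Q u β v)
  · refine CompEl.ind ?_
    rintro y (u | u) v <;> rfl
  · rintro (t | t) <;> induction t using CompEl.ind <;> rfl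
  · intro x x₁ z α t
    induction t using CompEl.ind with
    | h y u v => rcases u with u | u <;> rfl
  · intro x z z₁ t γ
    induction t using CompEl.ind with
    | h y u v => rcases u with u | u <;> rfl

lemma compBiset_sum_right (P : Profunctor.{u} C D) (Q Q' : Profunctor.{u} D E) :
    Nonempty (compBiset P (sumBiset Q Q') ≅ sumBiset (compBiset P Q) (compBiset P Q')) := by
  rw [nonempty_iso_iff]
  refine ⟨fun x z =>
    { toFun := CompEl.lift (Q := sumBiset Q Q')
        (T := El (compBiset P Q) x z ⊕ El (compBiset P Q') x z) (fun u v => Sum.map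
        (fun q => CompEl.mk P Q u q) (fun q => CompEl.mk P Q' u q) v) ?_
      invFun := Sum.elim
        (CompEl.lift (fun u v => CompEl.mk P (sumBiset Q Q') u (Sum.inl v))
          (fun u β v => CompEl.sound P (sumBiset Q Q') u β (Sum.inl v)))
        (CompEl.lift (fun u v => CompEl.mk P (sumBiset Q Q') u (Sum.inr v))
          (fun u β v => CompEl.sound P (sumBiset Q Q') u β (Sum.inr v)))
      left_inv := ?_
      right_inv := ?_ }, ?_, ?_⟩
  · rintro y₁ y₂ u β (v | v)
    · exact congrArg Sum.inl (CompEl.sound P Q u β v)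
    · exact congrArg Sum.inr (CompEl.sound P Q' u β v)
  · refine CompEl.ind ?_
    rintro y u (v | v) <;> rfl
  · rintro (t | t) <;> induction t using CompEl.ind <;> rfl
  · intro x x₁ z α t
    induction t using CompEl.ind with
    | h y u v => rcases v with v | v <;> rfl
  · intro x z z₁ t γ
    induction t using CompEl.ind with
    | h y u v => rcases v with v | v <;> rfl

lemma compBiset_assoc (P : Profunctor.{u} C D) (Q : Profunctor.{u} D E)
    (S : Profunctor.{u} E F) :
    Nonempty (compBiset (compBiset P Q) S ≅ compBiset P (compBiset Q S)) := by
  rw [nonempty_iso_iff]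
  refine ⟨fun x z =>
    { toFun := CompEl.lift (P := compBiset P Q)
        (fun {a} t s => CompEl.lift (fun u v => CompEl.mk P (compBiset Q S) (z := z) u
          (CompEl.mk Q S v s)) ?_ t) ?_
      invFun := CompEl.lift (Q := compBiset Q S)
        (fun {y} u t => CompEl.lift (fun v s => CompEl.mk (compBiset P Q) S (x := x)
          (CompEl.mk P Q u v) s) ?_ t) ?_
      left_inv := ?_
      right_inv := ?_ }, ?_, ?_⟩
  · intro y₁ y₂ u β v
    exact CompEl.sound P (compBiset Q S) u β (CompEl.mk Q S v s)
  · intro a₁ a₂ t β s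
    induction t using CompEl.ind with
    | h y u v =>
      exact congrArg (CompEl.mk P (compBiset Q S) (z := z) u) (CompEl.sound Q S v β s)
  · intro a₁ a₂ v β s
    exact CompEl.sound (compBiset P Q) S (CompEl.mk P Q u v) β s
  · intro y₁ y₂ u β t
    induction t using CompEl.ind with
    | h a v s =>
      exact congrArg (fun w => CompEl.mk (compBiset P Q) S (x := x) w s) (CompEl.sound P Q u β v)
  · refine CompEl.ind fun a t s => ?_
    induction t using CompEl.ind with
    | h y u v => rfl
  · refine CompEl.ind fun a u t => ?_
    induction t using CompEl.ind with
    | h y v s => rfl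
  · intro x x₁ z α t
    induction t using CompEl.ind with
    | h y t v =>
      induction t using CompEl.ind with
      | h y u v => rfl
  · intro x z z₁ t γ
    induction t using CompEl.ind with
    | h y t v =>
      induction t using CompEl.ind with
      | h y u v => rfl

/-- The identity biset, with value `Hom (y, x)` at `(x, y)`, is a left identity. -/
lemma compBiset_id_left (P : Profunctor.{u} C D) :
    Nonempty (compBiset (Profunctor.id (C := C)) P ≅ P) := by
  rw [nonempty_iso_iff]
  refine ⟨fun x z =>
    { toFun := CompEl.lift (P := Profunctor.id (C := C))
        (fun (α : _ ⟶ x) v => lact P α v) (fun α β v => lact_comp P β α v)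
      invFun := fun v => CompEl.mk (Profunctor.id (C := C)) P (𝟙 x) v
      left_inv := ?_
      right_inv := fun v => lact_id P v }, ?_, ?_⟩
  · refine CompEl.ind fun y (α : y ⟶ x) v => ?_
    refine (CompEl.sound (Profunctor.id (C := C)) P (𝟙 x) α v).symm.trans ?_
    exact congrArg (fun w => CompEl.mk (Profunctor.id (C := C)) P w v) (Category.comp_id α)
  · intro x x₁ z α t
    induction t using CompEl.ind with
    | h y β v => exact lact_comp P β α v
  · intro x z z₁ t γ
    induction t using CompEl.ind with
    | h y β v => exact lact_ract P β v γ

lemma compBiset_id_right (P : Profunctor.{u} C D) :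
    Nonempty (compBiset P (Profunctor.id (C := D)) ≅ P) := by
  rw [nonempty_iso_iff]
  refine ⟨fun x z =>
    { toFun := CompEl.lift (Q := Profunctor.id (C := D))
        (fun u (β : z ⟶ _) => ract P u β) (fun u β γ => (ract_comp P γ β u).symm)
      invFun := fun u => CompEl.mk P (Profunctor.id (C := D)) u (𝟙 z)
      left_inv := ?_
      right_inv := fun v => ract_id P v }, ?_, ?_⟩
  · refine CompEl.ind fun y u (β : z ⟶ y) => ?_
    refine (CompEl.sound P (Profunctor.id (C := D)) u β (𝟙 z)).trans ?_
    exact congrArg (fun w => CompEl.mk P (Profunctor.id (C := D)) u w) (Category.id_comp β)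
  · intro x x₁ z α t
    induction t using CompEl.ind with
    | h y u β => exact (lact_ract P α u β).symm
  · intro x z z₁ t γ
    induction t using CompEl.ind with
    | h y u β => exact ract_comp P γ β u

/-! ### Representable sets and bisets -/

/-- The left `C`-set that is the disjoint union of the sets `Hom (x i, -)`. -/
def sigmaHom {I : Type u} (x : I → C) : C ⥤ Type u where
  obj c := Σ i, (x i ⟶ c)
  map α := ↾(fun p => ⟨p.1, p.2 ≫ α⟩)

/-- A left `C`-set is representable if it is isomorphic to a disjoint union of sets
`Hom (x, -)`. -/
def IsRepresentableSet (G : C ⥤ Type u) : Prop :=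
  ∃ (I : Type u) (x : I → C), Nonempty (G ≅ sigmaHom x)

/-- A biset regarded as a left `C`-set: its value at `x` is the disjoint union over `y` of its
values at `(x, y)`. -/
def leftSet (P : Profunctor.{u} C D) : C ⥤ Type u where
  obj x := Σ y, El P x y
  map α := ↾(fun p => ⟨p.1, lact P α p.2⟩)
  map_id x := by ext p <;> simp
  map_comp α β := by ext p <;> simp [lact_comp]

/-- A biset regarded as a right `D`-set: its value at `y` is the disjoint union over `x` of its
values at `(x, y)`. -/
def rightSet (P : Profunctor.{u} C D) : Dᵒᵖ ⥤ Type u where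
  obj y := Σ x, El P x (unop y)
  map β := ↾(fun p => ⟨p.1, ract P p.2 β.unop⟩)
  map_id x := by ext p <;> simp
  map_comp α β := by ext p <;> simp [ract_comp]

/-- A biset is birepresentable if it is representable both as a left set and as a right set. -/
structure IsBirepresentable (P : Profunctor.{u} C D) : Prop where
  left : IsRepresentableSet (leftSet P)
  right : IsRepresentableSet (rightSet P)

/-- Representability through generators. -/
lemma isRepresentableSet_iff (G : C ⥤ Type u) : IsRepresentableSet G ↔
    ∃ (I : Type u) (x : I → C) (g : ∀ i, G.obj (x i)),
      ∀ (c : C) (t : G.obj c), ∃! p : (Σ i, (x i ⟶ c)), G.map p.2 (g p.1) = t := by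
  constructor
  · rintro ⟨I, x, ⟨e⟩⟩
    refine ⟨I, x, fun i => e.inv.app (x i) ⟨i, 𝟙 _⟩, fun c t => ?_⟩
    have key : ∀ p : (Σ i, (x i ⟶ c)),
        G.map p.2 (e.inv.app (x p.1) ⟨p.1, 𝟙 _⟩) = e.inv.app c p := by
      rintro ⟨i, f⟩
      have h : (sigmaHom x).map f ⟨i, 𝟙 (x i)⟩ = ⟨i, f⟩ :=
        congrArg (Sigma.mk i) (Category.id_comp f)
      exact (NatTrans.naturality_apply e.inv f _).symm.trans (congrArg (e.inv.app c) h)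
    refine ⟨e.hom.app c t, ?_, ?_⟩
    · exact (key (e.hom.app c t)).trans (ConcreteCategory.congr_hom (e.hom_inv_id_app c) t)
    · intro p hp
      have h := (key p).symm.trans hp
      rw [← h]
      exact (ConcreteCategory.congr_hom (e.inv_hom_id_app c) p).symm
  · rintro ⟨I, x, g, h⟩
    refine ⟨I, x, ⟨Iso.symm (NatIso.ofComponents (fun c => Equiv.toIso (Equiv.ofBijective
      (fun p : (Σ i, (x i ⟶ c)) => G.map p.2 (g p.1))
        ⟨fun p q hpq => ?_, fun t => (h c t).exists⟩)) ?_)⟩⟩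
    · exact (h c _).unique hpq rfl
    · intro c d f
      ext p
      exact Functor.map_comp_apply G p.2 f (g p.1)

lemma isRepresentableSet_leftSet_iff (P : Profunctor.{u} C D) :
    IsRepresentableSet (leftSet P) ↔
    ∀ y : D, ∃ (I : Type u) (x : I → C) (g : ∀ i, El P (x i) y),
      ∀ (c : C) (t : El P c y), ∃! p : (Σ i, (x i ⟶ c)), lact P p.2 (g p.1) = t := by
  rw [isRepresentableSet_iff]
  constructor
  · rintro ⟨I, x, g, h⟩ y
    have hg : ∀ i : {i // (g i).1 = y}, ∃ s : El P (x i) y, g i = ⟨y, s⟩ := by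
      rintro ⟨i, rfl⟩
      exact ⟨(g i).2, rfl⟩
    choose s hs using hg
    refine ⟨{i // (g i).1 = y}, fun i => x i.1, s, fun c t => ?_⟩
    have key : ∀ (i : I) (hi : (g i).1 = y) (f : x i ⟶ c),
        lact P f (s ⟨i, hi⟩) = t ↔ (leftSet P).map f (g i) = ⟨y, t⟩ := by
      intro i hi f
      rw [hs ⟨i, hi⟩]
      constructor
      · intro hh
        exact congrArg (Sigma.mk _) hh
      · intro hh
        exact eq_of_heq (Sigma.mk.inj hh).2
    obtain ⟨⟨i, f⟩, hf, huniq⟩ := h c ⟨y, t⟩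
    have hi : (g i).1 = y := congrArg Sigma.fst hf
    refine ⟨⟨⟨i, hi⟩, f⟩, (key i hi f).2 hf, ?_⟩
    rintro ⟨⟨j, hj⟩, f'⟩ hh
    have := huniq ⟨j, f'⟩ ((key j hj f').1 hh)
    cases this
    rfl
  · intro h
    choose I x g h using h
    refine ⟨Σ y, I y, fun p => x p.1 p.2, fun p => ⟨p.1, g p.1 p.2⟩, ?_⟩
    rintro c ⟨y, t⟩
    obtain ⟨⟨i, f⟩, hf, huniq⟩ := h y c t
    refine ⟨⟨⟨y, i⟩, f⟩, congrArg (Sigma.mk y) hf, ?_⟩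
    rintro ⟨⟨y', j⟩, f'⟩ hh
    have hy : y' = y := congrArg Sigma.fst hh
    subst hy
    have := huniq ⟨j, f'⟩ (eq_of_heq (Sigma.mk.inj hh).2)
    cases this
    rfl

lemma isRepresentableSet_rightSet_iff (P : Profunctor.{u} C D) :
    IsRepresentableSet (rightSet P) ↔
    ∀ x : C, ∃ (I : Type u) (y : I → D) (g : ∀ i, El P x (y i)),
      ∀ (d : D) (t : El P x d), ∃! p : (Σ i, (d ⟶ y i)), ract P (g p.1) p.2 = t := by
  rw [isRepresentableSet_iff]
  constructor
  · rintro ⟨I, y, g, h⟩ x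
    have hg : ∀ i : {i // (g i).1 = x}, ∃ s : El P x (unop (y i)), g i = ⟨x, s⟩ := by
      rintro ⟨i, rfl⟩
      exact ⟨(g i).2, rfl⟩
    choose s hs using hg
    refine ⟨{i // (g i).1 = x}, fun i => unop (y i.1), s, fun d t => ?_⟩
    have key : ∀ (i : I) (hi : (g i).1 = x) (f : d ⟶ unop (y i)),
        ract P (s ⟨i, hi⟩) f = t ↔ (rightSet P).map f.op (g i) = ⟨x, t⟩ := by
      intro i hi f
      rw [hs ⟨i, hi⟩]
      constructor
      · intro hh
        exact congrArg (Sigma.mk _) hh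
      · intro hh
        exact eq_of_heq (Sigma.mk.inj hh).2
    obtain ⟨⟨i, f⟩, hf, huniq⟩ := h (op d) ⟨x, t⟩
    have hi : (g i).1 = x := congrArg Sigma.fst hf
    refine ⟨⟨⟨i, hi⟩, f.unop⟩, (key i hi f.unop).2 hf, ?_⟩
    rintro ⟨⟨j, hj⟩, f'⟩ hh
    have := huniq ⟨j, f'.op⟩ ((key j hj f').1 hh)
    cases this
    rfl
  · intro h
    choose I y g h using h
    refine ⟨Σ x, I x, fun p => op (y p.1 p.2), fun p => ⟨p.1, g p.1 p.2⟩, ?_⟩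
    rintro d ⟨x, t⟩
    obtain ⟨⟨i, f⟩, hf, huniq⟩ := h x (unop d) t
    refine ⟨⟨⟨x, i⟩, f.op⟩, congrArg (Sigma.mk x) hf, ?_⟩
    rintro ⟨⟨x', j⟩, f'⟩ hh
    have hx : x' = x := congrArg Sigma.fst hh
    subst hx
    have := huniq ⟨j, f'.unop⟩ (eq_of_heq (Sigma.mk.inj hh).2)
    cases this
    rfl

lemma IsBirepresentable.empty : IsBirepresentable (emptyBiset : Profunctor.{u} C D) where
  left := (isRepresentableSet_leftSet_iff _).2 fun _ =>
    ⟨PEmpty, PEmpty.elim, fun i => i.elim, fun _ t => PEmpty.elim t⟩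
  right := (isRepresentableSet_rightSet_iff _).2 fun _ =>
    ⟨PEmpty, PEmpty.elim, fun i => i.elim, fun _ t => PEmpty.elim t⟩

lemma isRepresentableSet_left_compBiset {P : Profunctor.{u} C D} {Q : Profunctor.{u} D E}
    (hP : IsRepresentableSet (leftSet P)) (hQ : IsRepresentableSet (leftSet Q)) :
    IsRepresentableSet (leftSet (compBiset P Q)) := by
  rw [isRepresentableSet_leftSet_iff] at hP hQ ⊢
  intro z
  obtain ⟨J, b, ψ, hψ⟩ := hQ z
  choose I a ω hω using hP
  refine ⟨Σ j, I (b j), fun k => a _ k.2, fun k => CompEl.mk P Q (ω _ k.2) (ψ k.1), ?_⟩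
  intro c
  let gen : ∀ {y : D} (v : El Q y z), (Σ j, (b j ⟶ y)) := fun v => (hψ _ v).choose
  have gen_eq : ∀ {y : D} (j : J) (δ : b j ⟶ y), gen (lact Q δ (ψ j)) = ⟨j, δ⟩ :=
    fun j δ => ((hψ _ _).choose_spec.2 ⟨j, δ⟩ rfl).symm
  let can : CompEl P Q c z → (Σ j, El P c (b j)) :=
    CompEl.lift (fun u v => ⟨(gen v).1, ract P u (gen v).2⟩) (by
      intro y₁ y₂ u β v
      obtain ⟨⟨j, δ⟩, rfl, -⟩ := hψ _ v
      have h1 := congrArg (fun p : (Σ j, (b j ⟶ y₂)) =>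
        (⟨p.1, ract P (ract P u β) p.2⟩ : Σ j, El P c (b j))) (gen_eq j δ)
      have h2 := congrArg (fun p : (Σ j, (b j ⟶ y₁)) =>
        (⟨p.1, ract P u p.2⟩ : Σ j, El P c (b j))) (gen_eq j (δ ≫ β))
      rw [← lact_comp]
      exact h1.trans ((congrArg (Sigma.mk j) (ract_comp P δ β u).symm).trans h2.symm))
  have can_mk : ∀ (j : J) (u : El P c (b j)), can (CompEl.mk P Q u (ψ j)) = ⟨j, u⟩ := by
    intro j u
    have h : gen (ψ j) = ⟨j, 𝟙 _⟩ := by simpa using gen_eq j (𝟙 _)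
    change (⟨(gen (ψ j)).1, ract P u (gen (ψ j)).2⟩ : Σ j, El P c (b j)) = ⟨j, u⟩
    rw [h, ract_id]
  intro t
  obtain ⟨j, w, rfl⟩ : ∃ (j : J) (w : El P c (b j)), CompEl.mk P Q w (ψ j) = t := by
    induction t using CompEl.ind with
    | h y u v =>
      obtain ⟨⟨j, δ⟩, rfl, -⟩ := hψ _ v
      exact ⟨j, ract P u δ, CompEl.sound P Q u δ (ψ j)⟩
  obtain ⟨⟨i, f⟩, hf, huniq⟩ := hω (b j) c w
  refine ⟨⟨⟨j, i⟩, f⟩, congrArg (fun w => CompEl.mk P Q w (ψ j)) hf, ?_⟩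
  rintro ⟨⟨j', i'⟩, f'⟩ hh
  have h1 : can (CompEl.mk P Q (lact P f' (ω _ i')) (ψ j')) = can (CompEl.mk P Q w (ψ j)) :=
    congrArg can hh
  rw [can_mk, can_mk] at h1
  obtain ⟨rfl, h2⟩ := Sigma.mk.inj h1
  have := huniq ⟨i', f'⟩ (eq_of_heq h2)
  cases this
  rfl

lemma isRepresentableSet_right_compBiset {P : Profunctor.{u} C D} {Q : Profunctor.{u} D E}
    (hP : IsRepresentableSet (rightSet P)) (hQ : IsRepresentableSet (rightSet Q)) :
    IsRepresentableSet (rightSet (compBiset P Q)) := by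
  rw [isRepresentableSet_rightSet_iff] at hP hQ ⊢
  intro x
  obtain ⟨J, b, ψ, hψ⟩ := hP x
  choose I a ω hω using hQ
  refine ⟨Σ j, I (b j), fun k => a _ k.2, fun k => CompEl.mk P Q (ψ k.1) (ω _ k.2), ?_⟩
  intro c
  let gen : ∀ {y : D} (v : El P x y), (Σ j, (y ⟶ b j)) := fun v => (hψ _ v).choose
  have gen_eq : ∀ {y : D} (j : J) (δ : y ⟶ b j), gen (ract P (ψ j) δ) = ⟨j, δ⟩ :=
    fun j δ => ((hψ _ _).choose_spec.2 ⟨j, δ⟩ rfl).symm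
  let can : CompEl P Q x c → (Σ j, El Q (b j) c) :=
    CompEl.lift (fun v u => ⟨(gen v).1, lact Q (gen v).2 u⟩) (by
      intro y₁ y₂ v β u
      obtain ⟨⟨j, δ⟩, rfl, -⟩ := hψ _ v
      have h1 := congrArg (fun p : (Σ j, (y₂ ⟶ b j)) =>
        (⟨p.1, lact Q p.2 u⟩ : Σ j, El Q (b j) c)) (gen_eq j (β ≫ δ))
      have h2 := congrArg (fun p : (Σ j, (y₁ ⟶ b j)) =>
        (⟨p.1, lact Q p.2 (lact Q β u)⟩ : Σ j, El Q (b j) c)) (gen_eq j δ)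
      rw [← ract_comp]
      exact h1.trans ((congrArg (Sigma.mk j) (lact_comp Q β δ u)).trans h2.symm))
  have can_mk : ∀ (j : J) (u : El Q (b j) c), can (CompEl.mk P Q (ψ j) u) = ⟨j, u⟩ := by
    intro j u
    have h : gen (ψ j) = ⟨j, 𝟙 _⟩ := by simpa using gen_eq j (𝟙 _)
    change (⟨(gen (ψ j)).1, lact Q (gen (ψ j)).2 u⟩ : Σ j, El Q (b j) c) = ⟨j, u⟩
    rw [h, lact_id]
  intro t
  obtain ⟨j, w, rfl⟩ : ∃ (j : J) (w : El Q (b j) c), CompEl.mk P Q (ψ j) w = t := by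
    induction t using CompEl.ind with
    | h y v u =>
      obtain ⟨⟨j, δ⟩, rfl, -⟩ := hψ _ v
      exact ⟨j, lact Q δ u, (CompEl.sound P Q (ψ j) δ u).symm⟩
  obtain ⟨⟨i, f⟩, hf, huniq⟩ := hω (b j) c w
  refine ⟨⟨⟨j, i⟩, f⟩, congrArg (fun w => CompEl.mk P Q (ψ j) w) hf, ?_⟩
  rintro ⟨⟨j', i'⟩, f'⟩ hh
  have h1 : can (CompEl.mk P Q (ψ j') (ract Q (ω _ i') f')) = can (CompEl.mk P Q (ψ j) w) :=
    congrArg can hh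
  rw [can_mk, can_mk] at h1
  obtain ⟨rfl, h2⟩ := Sigma.mk.inj h1
  have := huniq ⟨i', f'⟩ (eq_of_heq h2)
  cases this
  rfl

/-- Composites of birepresentable bisets are birepresentable. -/
lemma IsBirepresentable.comp {P : Profunctor.{u} C D} {Q : Profunctor.{u} D E}
    (hP : IsBirepresentable P) (hQ : IsBirepresentable Q) :
    IsBirepresentable (compBiset P Q) :=
  ⟨isRepresentableSet_left_compBiset hP.left hQ.left,
    isRepresentableSet_right_compBiset hP.right hQ.right⟩

/-- The biset with value `Hom (F y, x)` at `(x, y)` is birepresentable if `F` has a right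
adjoint. -/
lemma IsBirepresentable.of_adj {G : D ⥤ C} {H : C ⥤ D} (adj : G ⊣ H) :
    IsBirepresentable G.toProfunctorRev where
  left := (isRepresentableSet_leftSet_iff _).2 fun y =>
    ⟨PUnit, fun _ => G.obj y, fun _ => 𝟙 (G.obj y), fun c (t : G.obj y ⟶ c) => by
      refine ⟨⟨⟨⟩, t⟩, Category.id_comp t, ?_⟩
      rintro ⟨⟨⟩, f⟩ (hf : 𝟙 (G.obj y) ≫ f = t)
      rw [← hf, Category.id_comp]⟩
  right := (isRepresentableSet_rightSet_iff _).2 fun x =>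
    ⟨PUnit, fun _ => H.obj x, fun _ => adj.counit.app x, fun d (t : G.obj d ⟶ x) => by
      have h : ∀ f : d ⟶ H.obj x, G.map f ≫ adj.counit.app x = (adj.homEquiv d x).symm f :=
        fun f => (adj.homEquiv_counit _ _ f).symm
      refine ⟨⟨⟨⟩, adj.homEquiv d x t⟩, (h _).trans (Equiv.symm_apply_apply _ t), ?_⟩
      rintro ⟨⟨⟩, f⟩ (hf : G.map f ≫ adj.counit.app x = t)
      rw [← hf, h]
      exact congrArg (Sigma.mk PUnit.unit) (Equiv.apply_symm_apply _ f).symm⟩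

lemma IsBirepresentable.id : IsBirepresentable (Profunctor.id (C := C)) :=
  IsBirepresentable.of_adj (G := 𝟭 C) (H := 𝟭 C) Adjunction.id

end Bisets

/-! ### The category of finite categories and birepresentable bisets -/

/-- A finite category. -/
structure FinCat : Type (u + 1) where
  carrier : Type u
  [cat : SmallCategory carrier]
  [finite_obj : Finite carrier]
  [finite_hom : ∀ x y : carrier, Finite (x ⟶ y)]

attribute [instance] FinCat.cat FinCat.finite_obj FinCat.finite_hom

/-- Finite birepresentable `(C, D)`-bisets. -/
structure Biset11 (C D : FinCat.{u}) : Type (u + 1) where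
  toProf : Profunctor.{u} C.carrier D.carrier
  finite : ∀ x y, Finite (El toProf x y)
  birep : IsBirepresentable toProf

namespace Biset11

/-- Isomorphism of bisets. -/
def IsIso {C D : FinCat.{u}} (P Q : Biset11 C D) : Prop := Nonempty (P.toProf ≅ Q.toProf)

/-- `P` is isomorphic to the disjoint union of `P₁` and `P₂`. -/
def IsSum {C D : FinCat.{u}} (P P₁ P₂ : Biset11 C D) : Prop :=
  Nonempty (P.toProf ≅ sumBiset P₁.toProf P₂.toProf)

/-- The empty biset. -/
def empty (C D : FinCat.{u}) : Biset11 C D where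
  toProf := emptyBiset
  finite _ _ := inferInstanceAs (Finite PEmpty)
  birep := .empty

/-- The composite `P ∘ Q`. -/
def comp {C D E : FinCat.{u}} (P : Biset11 C D) (Q : Biset11 D E) : Biset11 C E where
  toProf := compBiset P.toProf Q.toProf
  finite x z := by
    have h₁ := P.finite
    have h₂ := Q.finite
    exact inferInstanceAs (Finite (Quot (CompRel P.toProf Q.toProf x z)))
  birep := P.birep.comp Q.birep

/-- The biset with value `Hom (G y, x)` at `(x, y)`, for a functor `G` with a right adjoint. -/
def ofFunctor {C D : FinCat.{u}} (G : D.carrier ⥤ C.carrier) (hG : G.IsLeftAdjoint) :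
    Biset11 C D where
  toProf := G.toProfunctorRev
  finite x y := inferInstanceAs (Finite (G.obj y ⟶ x))
  birep := .of_adj (Adjunction.ofIsLeftAdjoint G)

/-- The identity biset, with value `Hom (y, x)` at `(x, y)`. -/
def id (C : FinCat.{u}) : Biset11 C C where
  toProf := Profunctor.id
  finite x y := inferInstanceAs (Finite (y ⟶ x))
  birep := .id

end Biset11

/-- The relations `P - (P₁ + P₂)` for `P ≅ P₁ ⊔ P₂`. -/
def sumRelations (C D : FinCat.{u}) : AddSubgroup (FreeAbelianGroup (Biset11 C D)) :=
  AddSubgroup.closure {t | ∃ P P₁ P₂ : Biset11 C D, P.IsSum P₁ P₂ ∧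
    t = FreeAbelianGroup.of P - (FreeAbelianGroup.of P₁ + FreeAbelianGroup.of P₂)}

/-- The Grothendieck group of finite birepresentable `(C, D)`-bisets with respect to disjoint
union. -/
abbrev A11 (C D : FinCat.{u}) : Type (u + 1) :=
  FreeAbelianGroup (Biset11 C D) ⧸ sumRelations C D

/-- The class of a biset in the Grothendieck group. -/
def A11.cls {C D : FinCat.{u}} (P : Biset11 C D) : A11 C D :=
  QuotientAddGroup.mk (FreeAbelianGroup.of P)

lemma A11.cls_sum {C D : FinCat.{u}} {P P₁ P₂ : Biset11 C D} (h : P.IsSum P₁ P₂) :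
    cls P = cls P₁ + cls P₂ := by
  rw [← sub_eq_zero]
  exact (QuotientAddGroup.eq_zero_iff _).2 (AddSubgroup.subset_closure ⟨P, P₁, P₂, h, rfl⟩)

lemma A11.cls_empty (C D : FinCat.{u}) : cls (Biset11.empty C D) = 0 := by
  have h : (Biset11.empty C D).IsSum (Biset11.empty C D) (Biset11.empty C D) := by
    refine nonempty_iso_iff.2 ⟨fun x y => ⟨fun t => PEmpty.elim t, ?_, fun t => PEmpty.elim t, ?_⟩,
      fun _ t => PEmpty.elim t, fun t _ => PEmpty.elim t⟩
    · exact Sum.elim (fun t => t) (fun t => t)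
    · rintro (t | t) <;> exact PEmpty.elim t
  have := A11.cls_sum h
  simpa using this

lemma A11.cls_iso {C D : FinCat.{u}} {P Q : Biset11 C D} (h : P.IsIso Q) : cls P = cls Q := by
  have h' : P.IsSum Q (Biset11.empty C D) := by
    obtain ⟨e, hl, hr⟩ := nonempty_iso_iff.1 h
    refine nonempty_iso_iff.2 ⟨fun x y => (e x y).trans
      ⟨Sum.inl, Sum.elim (fun t => t) (fun t => PEmpty.elim t), fun _ => rfl, ?_⟩, ?_, ?_⟩
    · rintro (t | t)
      · rfl
      · exact PEmpty.elim t
    · intro x x₁ y α t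
      exact congrArg Sum.inl (hl α t)
    · intro x y y₁ t β
      exact congrArg Sum.inl (hr t β)
  rw [A11.cls_sum h', A11.cls_empty, add_zero]

lemma A11.induction {C D : FinCat.{u}} {p : A11 C D → Prop} (h0 : p 0)
    (hcls : ∀ P, p (cls P)) (hneg : ∀ P, p (cls P) → p (-cls P))
    (hadd : ∀ a b, p a → p b → p (a + b)) (a : A11 C D) : p a := by
  induction a using QuotientAddGroup.induction_on with
  | H a =>
    induction a using FreeAbelianGroup.induction_on with
    | zero => exact h0
    | of P => exact hcls P
    | neg P h => exact hneg P h
    | add a b ha hb => exact hadd _ _ ha hb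

/-- Two additive maps out of the Grothendieck group that agree on bisets are equal. -/
lemma A11.hom_ext {C D : FinCat.{u}} {B : Type*} [AddCommGroup B] {f g : A11 C D →+ B}
    (h : ∀ P, f (cls P) = g (cls P)) : f = g := by
  refine DFunLike.ext _ _ fun a => ?_
  induction a using A11.induction with
  | h0 => simp
  | hcls P => exact h P
  | hneg P hP => simp [hP]
  | hadd a b ha hb => simp [ha, hb]

/-- Additive maps out of the Grothendieck group. -/
def A11.lift {C D : FinCat.{u}} {B : Type*} [AddCommGroup B] (f : Biset11 C D → B)
    (hf : ∀ {P P₁ P₂}, P.IsSum P₁ P₂ → f P = f P₁ + f P₂) : A11 C D →+ B :=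
  QuotientAddGroup.lift _ (FreeAbelianGroup.lift f) (by
    rw [sumRelations, AddSubgroup.closure_le]
    rintro _ ⟨P, P₁, P₂, h, rfl⟩
    simp [hf h])

@[simp] lemma A11.lift_cls {C D : FinCat.{u}} {B : Type*} [AddCommGroup B]
    (f : Biset11 C D → B) (hf : ∀ {P P₁ P₂}, P.IsSum P₁ P₂ → f P = f P₁ + f P₂)
    (P : Biset11 C D) : A11.lift f hf (cls P) = f P :=
  FreeAbelianGroup.lift_apply_of f P

/-- Composition with a fixed biset on the left. -/
def A11.compLeft {C D E : FinCat.{u}} (P : Biset11 C D) : A11 D E →+ A11 C E :=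
  A11.lift (fun Q => cls (P.comp Q)) (fun {Q Q₁ Q₂} h => A11.cls_sum (by
    obtain ⟨i⟩ := compBiset_congr (P := P.toProf) ⟨Iso.refl _⟩ h
    obtain ⟨j⟩ := compBiset_sum_right P.toProf Q₁.toProf Q₂.toProf
    exact ⟨i ≪≫ j⟩))

lemma A11.compLeft_cls {C D E : FinCat.{u}} (P : Biset11 C D) (Q : Biset11 D E) :
    A11.compLeft P (cls Q) = cls (P.comp Q) :=
  FreeAbelianGroup.lift_apply_of _ _

/-- The biadditive map given on bisets by composition. -/
def A11.comp (C D E : FinCat.{u}) : A11 C D →+ A11 D E →+ A11 C E :=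
  A11.lift A11.compLeft (fun {P P₁ P₂} h => A11.hom_ext fun Q => by
    rw [AddMonoidHom.add_apply, A11.compLeft_cls, A11.compLeft_cls, A11.compLeft_cls]
    refine A11.cls_sum ?_
    obtain ⟨i⟩ := compBiset_congr (Q := Q.toProf) h ⟨Iso.refl _⟩
    obtain ⟨j⟩ := compBiset_sum_left P₁.toProf P₂.toProf Q.toProf
    exact ⟨i ≪≫ j⟩)

lemma A11.comp_cls {C D E : FinCat.{u}} (P : Biset11 C D) (Q : Biset11 D E) :
    A11.comp C D E (cls P) (cls Q) = cls (P.comp Q) :=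
  (DFunLike.congr_fun (FreeAbelianGroup.lift_apply_of A11.compLeft P) (cls Q)).trans
    (A11.compLeft_cls P Q)

open scoped TensorProduct

variable (R : Type w) [CommRing R]

/-- The Grothendieck group with coefficients in `R`. -/
abbrev AR11 (C D : FinCat.{u}) : Type (max w (u + 1)) := R ⊗[ℤ] A11 C D

/-- The class of a biset. -/
def AR11.cls {C D : FinCat.{u}} (P : Biset11 C D) : AR11 R C D := 1 ⊗ₜ[ℤ] A11.cls P

lemma AR11.induction {C D : FinCat.{u}} {p : AR11 R C D → Prop} (h0 : p 0)
    (hcls : ∀ (r : R) P, p (r ⊗ₜ[ℤ] A11.cls P)) (hadd : ∀ a b, p a → p b → p (a + b))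
    (a : AR11 R C D) : p a := by
  induction a using TensorProduct.induction_on with
  | zero => exact h0
  | add a b ha hb => exact hadd _ _ ha hb
  | tmul r a =>
    induction a using A11.induction generalizing r with
    | h0 => simpa using h0
    | hcls P => exact hcls r P
    | hneg P h =>
      rw [TensorProduct.tmul_neg, ← TensorProduct.neg_tmul]
      exact h _
    | hadd a b ha hb =>
      rw [TensorProduct.tmul_add]
      exact hadd _ _ (ha _) (hb _)

/-- Composition of bisets, extended bilinearly:
`(r ⊗ P) ∘ (s ⊗ Q) = r s ⊗ (P ∘ Q)`. -/
def AR11.comp (C D E : FinCat.{u}) : AR11 R C D →+ AR11 R D E →+ AR11 R C E :=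
  AddMonoidHom.mk' (fun a => (TensorProduct.map₂ (LinearMap.mul ℤ R)
    (LinearMap.mk₂ ℤ (fun a b => A11.comp C D E a b) (by simp) (by simp) (by simp) (by simp))
    a).toAddMonoidHom) (fun a b => by rw [map_add]; rfl)

lemma AR11.comp_tmul {C D E : FinCat.{u}} (r s : R) (P : Biset11 C D) (Q : Biset11 D E) :
    AR11.comp R C D E (r ⊗ₜ A11.cls P) (s ⊗ₜ A11.cls Q) = (r * s) ⊗ₜ A11.cls (P.comp Q) :=
  congrArg (fun t => (r * s) ⊗ₜ[ℤ] t) (A11.comp_cls P Q)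

lemma AR11.comp_smul_left {C D E : FinCat.{u}} (r : R) (f : AR11 R C D) (g : AR11 R D E) :
    AR11.comp R C D E (r • f) g = r • AR11.comp R C D E f g := by
  induction f using AR11.induction with
  | h0 => simp
  | hadd a b ha hb => simp only [smul_add, map_add, AddMonoidHom.add_apply, ha, hb]
  | hcls s P =>
    induction g using AR11.induction with
    | h0 => simp
    | hadd a b ha hb => simp only [smul_add, map_add, ha, hb]
    | hcls t Q => simp only [TensorProduct.smul_tmul', AR11.comp_tmul, smul_eq_mul, mul_assoc]

lemma AR11.comp_smul_right {C D E : FinCat.{u}} (r : R) (f : AR11 R C D) (g : AR11 R D E) :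
    AR11.comp R C D E f (r • g) = r • AR11.comp R C D E f g := by
  induction f using AR11.induction with
  | h0 => simp
  | hadd a b ha hb => simp only [smul_add, map_add, AddMonoidHom.add_apply, ha, hb]
  | hcls s P =>
    induction g using AR11.induction with
    | h0 => simp
    | hadd a b ha hb => simp only [smul_add, map_add, ha, hb]
    | hcls t Q => simp only [TensorProduct.smul_tmul', AR11.comp_tmul, smul_eq_mul, mul_left_comm]

/-- The `R`-linear category whose objects are the finite categories, with
`Hom (C, D) = R ⊗ (Grothendieck group of finite birepresentable (D, C)-bisets)`. -/
structure B11 (R : Type w) : Type (u + 1) where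
  cat : FinCat.{u}

variable {R}

instance : Category.{max w (u + 1)} (B11.{w, u} R) where
  Hom X Y := AR11 R Y.cat X.cat
  id X := AR11.cls R (Biset11.id X.cat)
  comp {X Y Z} f g := AR11.comp R Z.cat Y.cat X.cat g f
  id_comp {X Y} f := by
    induction f using AR11.induction with
    | h0 => simp
    | hadd a b ha hb => rw [map_add, AddMonoidHom.add_apply, ha, hb]
    | hcls r P =>
      have h : (P.comp (Biset11.id _)).IsIso P := compBiset_id_right P.toProf
      rw [AR11.cls, AR11.comp_tmul, mul_one, A11.cls_iso h]
  comp_id {X Y} f := by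
    induction f using AR11.induction with
    | h0 => simp
    | hadd a b ha hb => rw [map_add, ha, hb]
    | hcls r P =>
      have h : ((Biset11.id _).comp P).IsIso P := compBiset_id_left P.toProf
      rw [AR11.cls, AR11.comp_tmul, one_mul, A11.cls_iso h]
  assoc {X Y Z W} f g h := by
    induction f using AR11.induction with
    | h0 => simp
    | hadd a b ha hb => simp only [map_add, ha, hb]
    | hcls r P =>
      induction g using AR11.induction with
      | h0 => simp
      | hadd a b ha hb => simp only [map_add, AddMonoidHom.add_apply, ha, hb]
      | hcls s Q =>
        induction h using AR11.induction with
        | h0 => simp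
        | hadd a b ha hb => simp only [map_add, AddMonoidHom.add_apply, ha, hb]
        | hcls t S =>
          have h : ((S.comp Q).comp P).IsIso (S.comp (Q.comp P)) :=
            compBiset_assoc S.toProf Q.toProf P.toProf
          simp only [AR11.comp_tmul, mul_assoc, A11.cls_iso h]

instance (X Y : B11.{w, u} R) : AddCommGroup (X ⟶ Y) :=
  inferInstanceAs (AddCommGroup (AR11 R Y.cat X.cat))

instance (X Y : B11.{w, u} R) : Module R (X ⟶ Y) :=
  inferInstanceAs (Module R (AR11 R Y.cat X.cat))

instance : Preadditive (B11.{w, u} R) where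
  homGroup _ _ := inferInstance
  add_comp X Y Z f f' g := map_add (AR11.comp R Z.cat Y.cat X.cat g) f f'
  comp_add X Y Z f g g' :=
    (DFunLike.congr_fun (map_add (AR11.comp R Z.cat Y.cat X.cat) g g') f :)

instance : Linear R (B11.{w, u} R) where
  homModule _ _ := inferInstance
  smul_comp _ _ _ r f g := AR11.comp_smul_right R r g f
  comp_smul _ _ _ f r g := AR11.comp_smul_left R r g f

variable (R) in
/-- The morphism `C ⟶ D` given by a birepresentable `(D, C)`-biset. -/
def B11.cls {C D : FinCat.{u}} (P : Biset11 D C) : (B11.mk C : B11.{w, u} R) ⟶ B11.mk D :=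
  AR11.cls R P

/-! ### Correspondences -/

/-- The category of finite sets and correspondences. -/
structure Corresp : Type (u + 1) where
  carrier : Type u
  [finite : Finite carrier]

attribute [instance] Corresp.finite

/-- A morphism `X ⟶ Y` is a subset of `Y × X`. -/
instance : Category.{u} Corresp.{u} where
  Hom X Y := Set (Y.carrier × X.carrier)
  id X := {p | p.1 = p.2}
  comp {X Y Z} V U := {p | ∃ y : Y.carrier, (p.1, y) ∈ U ∧ (y, p.2) ∈ V}
  id_comp f := by ext ⟨y, x⟩; simp
  comp_id f := by ext ⟨y, x⟩; simp
  assoc f g h := by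
    ext ⟨w, x⟩
    simp only [Set.mem_ofPred_eq]
    tauto

/-- The Boolean lattice of subsets of a finite set, as a finite category. -/
def powerCat (X : Corresp.{u}) : FinCat.{u} where
  carrier := Set X.carrier
  finite_hom A B := inferInstanceAs (Finite (ULift (PLift (A ≤ B))))

/-- The map `A ↦ {y | ∃ x ∈ A, (y, x) ∈ U}` on subsets. -/
def imageMap {X Y : Corresp.{u}} (U : X ⟶ Y) (A : Set X.carrier) : Set Y.carrier :=
  {y | ∃ x ∈ A, (y, x) ∈ (show Set (Y.carrier × X.carrier) from U)}

lemma imageMap_gc {X Y : Corresp.{u}} (U : X ⟶ Y) : GaloisConnection (imageMap U)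
    (fun B => {x | ∀ y, (y, x) ∈ (show Set (Y.carrier × X.carrier) from U) → y ∈ B}) := by
  intro A B
  constructor
  · intro h x hx y hy
    exact h ⟨x, hx, hy⟩
  · rintro h y ⟨x, hx, hy⟩
    exact h hx y hy

/-- The functor between Boolean lattices given by `imageMap`. -/
def imageFunctor {X Y : Corresp.{u}} (U : X ⟶ Y) :
    (powerCat X).carrier ⥤ (powerCat Y).carrier :=
  (imageMap_gc U).monotone_l.functor

lemma imageFunctor_isLeftAdjoint {X Y : Corresp.{u}} (U : X ⟶ Y) :
    (imageFunctor U).IsLeftAdjoint :=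
  (imageMap_gc U).adjunction.isLeftAdjoint

variable (R) in
/-- The class of the `(2^Y, 2^X)`-biset with value `Hom (imageMap U A, B)` at `(B, A)`. -/
def correspMap {X Y : Corresp.{u}} (U : X ⟶ Y) :
    (B11.mk (powerCat X) : B11.{w, u} R) ⟶ B11.mk (powerCat Y) :=
  B11.cls R (Biset11.ofFunctor (imageFunctor U) (imageFunctor_isLeftAdjoint U))

/-! ### Essential algebras -/

/-- The linear span of a set, as a left ideal. -/
def spanIdeal (R : Type*) {A : Type*} [CommRing R] [Ring A] [Algebra R A] (S : Set A)
    (hl : ∀ a, ∀ s ∈ S, a * s ∈ Submodule.span R S) : Ideal A where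
  toAddSubmonoid := (Submodule.span R S).toAddSubmonoid
  smul_mem' a x hx := by
    change a * x ∈ Submodule.span R S
    change x ∈ Submodule.span R S at hx
    induction hx using Submodule.span_induction with
    | mem s hs => exact hl a s hs
    | zero => simp
    | add x y _ _ hx hy => rw [mul_add]; exact add_mem hx hy
    | smul r x _ hx => rw [mul_smul_comm]; exact Submodule.smul_mem _ r hx

lemma spanIdeal_isTwoSided (R : Type*) {A : Type*} [CommRing R] [Ring A] [Algebra R A]
    (S : Set A) (hl : ∀ a, ∀ s ∈ S, a * s ∈ Submodule.span R S)
    (hr : ∀ a, ∀ s ∈ S, s * a ∈ Submodule.span R S) : (spanIdeal R S hl).IsTwoSided where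
  mul_mem_of_left {x} a hx := by
    change x * a ∈ Submodule.span R S
    change x ∈ Submodule.span R S at hx
    induction hx using Submodule.span_induction with
    | mem s hs => exact hr a s hs
    | zero => simp
    | add x y _ _ hx hy => rw [add_mul]; exact add_mem hx hy
    | smul r x _ hx => rw [smul_mul_assoc]; exact Submodule.smul_mem _ r hx

variable (R)

/-- A correspondence on `X` as an element of the endomorphism algebra of `X` in the linearized
correspondence category. -/
noncomputable def correspEnd {X : Corresp.{u}} (U : X ⟶ X) : End (Free.of R X) :=
  (Free.embedding R Corresp.{u}).map U

/-- A birepresentable `(C, C)`-biset as an element of the endomorphism algebra of `C`. -/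
def bisetEnd {C : FinCat.{u}} (P : Biset11 C C) : End (B11.mk C : B11.{w, u} R) :=
  B11.cls R P

/-- The correspondences on `X` that factor through a smaller set. -/
def inessCorrespSet (X : Corresp.{u}) : Set (End (Free.of R X)) :=
  {t | ∃ Z : Corresp.{u}, Nat.card Z.carrier < Nat.card X.carrier ∧
    ∃ (W : X ⟶ Z) (V : Z ⟶ X), t = correspEnd R (W ≫ V)}

/-- The birepresentable bisets for `2^X` that factor birepresentably through `2^Z` for a smaller
set `Z`. -/
def inessBisetSet (X : Corresp.{u}) : Set (End (B11.mk (powerCat X) : B11.{w, u} R)) :=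
  {t | ∃ Z : Corresp.{u}, Nat.card Z.carrier < Nat.card X.carrier ∧
    ∃ (Q : Biset11 (powerCat X) (powerCat Z)) (S : Biset11 (powerCat Z) (powerCat X)),
      t = bisetEnd R (Q.comp S)}

variable {R}

lemma correspEnd_mul {X : Corresp.{u}} (U V : X ⟶ X) :
    correspEnd R U * correspEnd R V = correspEnd R (V ≫ U) :=
  ((Free.embedding R Corresp.{u}).map_comp V U).symm

lemma correspEnd_induction {X : Corresp.{u}} {p : End (Free.of R X) → Prop} (h0 : p 0)
    (hsmul : ∀ (r : R) (U : X ⟶ X), p (r • correspEnd R U))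
    (hadd : ∀ a b, p a → p b → p (a + b)) (a : End (Free.of R X)) : p a := by
  refine Finsupp.induction_linear (motive := p) a h0 hadd fun U r => ?_
  have h : r • correspEnd R U = (Finsupp.single U r : (X ⟶ X) →₀ R) :=
    Finsupp.smul_single_one U r
  exact h ▸ hsmul r U

lemma bisetEnd_mul {C : FinCat.{u}} (P Q : Biset11 C C) :
    bisetEnd R P * bisetEnd R Q = bisetEnd R (P.comp Q) :=
  (AR11.comp_tmul R 1 1 P Q).trans (by rw [one_mul]; rfl)

lemma bisetEnd_iso {C : FinCat.{u}} {P Q : Biset11 C C} (h : P.IsIso Q) :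
    bisetEnd R P = bisetEnd R Q :=
  congrArg (fun t => (1 : R) ⊗ₜ[ℤ] t) (A11.cls_iso h)

lemma bisetEnd_induction {C : FinCat.{u}} {p : End (B11.mk C : B11.{w, u} R) → Prop} (h0 : p 0)
    (hsmul : ∀ (r : R) (P : Biset11 C C), p (r • bisetEnd R P))
    (hadd : ∀ a b, p a → p b → p (a + b)) (a : End (B11.mk C : B11.{w, u} R)) : p a := by
  refine AR11.induction R (p := p) h0 (fun r P => ?_) hadd a
  have h : r • bisetEnd R P = r ⊗ₜ[ℤ] A11.cls P :=
    (TensorProduct.smul_tmul' r (1 : R) (A11.cls P)).trans (by rw [smul_eq_mul, mul_one])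
  exact h ▸ hsmul r P

lemma inessCorrespSet_mul (X : Corresp.{u}) (a : End (Free.of R X)) :
    ∀ t ∈ inessCorrespSet R X, a * t ∈ Submodule.span R (inessCorrespSet R X) ∧
      t * a ∈ Submodule.span R (inessCorrespSet R X) := by
  rintro _ ⟨Z, hZ, W, V, rfl⟩
  induction a using correspEnd_induction with
  | h0 => simp
  | hadd a b ha hb =>
    rw [add_mul, mul_add]
    exact ⟨add_mem ha.1 hb.1, add_mem ha.2 hb.2⟩
  | hsmul r U =>
    rw [smul_mul_assoc, mul_smul_comm, correspEnd_mul, correspEnd_mul]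
    refine ⟨Submodule.smul_mem _ r (Submodule.subset_span ⟨Z, hZ, W, V ≫ U, ?_⟩),
      Submodule.smul_mem _ r (Submodule.subset_span ⟨Z, hZ, U ≫ W, V, ?_⟩)⟩ <;>
    rw [Category.assoc]

lemma inessBisetSet_mul (X : Corresp.{u}) (a : End (B11.mk (powerCat X) : B11.{w, u} R)) :
    ∀ t ∈ inessBisetSet R X, a * t ∈ Submodule.span R (inessBisetSet R X) ∧
      t * a ∈ Submodule.span R (inessBisetSet R X) := by
  rintro _ ⟨Z, hZ, Q, S, rfl⟩
  induction a using bisetEnd_induction with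
  | h0 => simp
  | hadd a b ha hb =>
    rw [add_mul, mul_add]
    exact ⟨add_mem ha.1 hb.1, add_mem ha.2 hb.2⟩
  | hsmul r P =>
    rw [smul_mul_assoc, mul_smul_comm, bisetEnd_mul, bisetEnd_mul]
    refine ⟨Submodule.smul_mem _ r (Submodule.subset_span ⟨Z, hZ, P.comp Q, S, ?_⟩),
      Submodule.smul_mem _ r (Submodule.subset_span ⟨Z, hZ, Q, S.comp P, ?_⟩)⟩
    · obtain ⟨i⟩ := compBiset_assoc P.toProf Q.toProf S.toProf
      exact bisetEnd_iso ⟨i.symm⟩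
    · exact bisetEnd_iso (compBiset_assoc Q.toProf S.toProf P.toProf)

variable (R)

/-- The inessential ideal of `X` in the linearized correspondence category: the span of the
correspondences that factor through a smaller set. -/
noncomputable def inessCorresp (X : Corresp.{u}) : Ideal (End (Free.of R X)) :=
  spanIdeal R (inessCorrespSet R X) fun a t ht => (inessCorrespSet_mul X a t ht).1

instance (X : Corresp.{u}) : (inessCorresp R X).IsTwoSided :=
  spanIdeal_isTwoSided R _ _ fun a t ht => (inessCorrespSet_mul X a t ht).2

/-- The essential algebra of `X` in the linearized correspondence category. -/
noncomputable abbrev EssCorresp (X : Corresp.{u}) : Type (max w u) :=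
  End (Free.of R X) ⧸ inessCorresp R X

/-- The inessential ideal of `2^X`: the span of the birepresentable bisets that factor
birepresentably through `2^Z` for a set `Z` smaller than `X`. -/
def inessBiset (X : Corresp.{u}) : Ideal (End (B11.mk (powerCat X) : B11.{w, u} R)) :=
  spanIdeal R (inessBisetSet R X) fun a t ht => (inessBisetSet_mul X a t ht).1

instance (X : Corresp.{u}) : (inessBiset R X).IsTwoSided :=
  spanIdeal_isTwoSided R _ _ fun a t ht => (inessBisetSet_mul X a t ht).2

/-- The essential algebra of `2^X`. -/
abbrev EssBiset (X : Corresp.{u}) : Type (max w (u + 1)) :=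
  End (B11.mk (powerCat X) : B11.{w, u} R) ⧸ inessBiset R X

end BisetCorr

open CategoryTheory BisetCorr

namespace BisetCorr

/-! The point is that a birepresentable biset `P` over Boolean lattices is nothing but a finite
family of relations. As a left set, `P(-, A)` is a disjoint union of representables on a poset with
greatest element `univ`, so each representable has at most one element at each place and exactly one
at `univ`; hence transport `P(B, A) → P(univ, A)` is injective. Dually, transport along `∅ ⊆ A` is
injective. So `P` embeds in the constant biset on `P(univ, ∅)` and splits into components indexed by
that set, each described by the relation "the component has an element at `(B, A)`".
Representability says exactly that nonempty rows and columns of this relation are principal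
(`isLinked_componentRel`, `isIso_relBiset`).

A nonempty linked relation on the subsets of `X` is of one of two kinds. If it is full, it is a
Galois connection between power sets, hence of the form `imageMap U A ⊆ B` for a unique
correspondence `U` (`IsLinked.iff_imageMap`, `relCorr_imageMap`). Otherwise its least first entry is
nonempty or its greatest second entry is proper, and it factors through the subsets of a proper
subset of `X` (`IsLinked.exists_factorization`). Modulo inessential bisets only correspondences
survive, which gives surjectivity.

For injectivity, send a biset to the sum of the classes of the correspondences of its full
components, with non-full components sent to zero. This linear map is a retraction onto the
essential algebra of correspondences (`componentMap_correspAlgHom`). It kills the inessential bisets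
because a component of a composite is the composite of one component of each factor
(`exists_componentRel_compBiset_eq`), and if such a composite through `2^Z` is full, then its
correspondence factors through `Z`, even when the two factors are not full (`relCorr_relComp`). -/

/-! ### Relations between Boolean lattices -/

/-- The relations `r B A` on subsets whose truth values form a birepresentable biset. -/
structure IsLinked {X Y : Type u} (r : Set Y → Set X → Prop) : Prop where
  mono : ∀ {B B' A A'}, B ⊆ B' → A' ⊆ A → r B A → r B' A'
  left : ∀ A, r Set.univ A → ∃ x, ∀ B, r B A ↔ x ⊆ B
  right : ∀ B, r B ∅ → ∃ y, ∀ A, r B A ↔ A ⊆ y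

/-- A relation is full if it relates `∅` to `∅` and the whole sets to each other. -/
def IsFull {X Y : Type u} (r : Set Y → Set X → Prop) : Prop :=
  r ∅ ∅ ∧ r Set.univ Set.univ

/-- The composite of relations. -/
def relComp {X Y Z : Type u} (p : Set Y → Set Z → Prop) (q : Set Z → Set X → Prop) :
    Set Y → Set X → Prop :=
  fun B A => ∃ C, p B C ∧ q C A

/-- The correspondence underlying a relation on subsets. -/
def relCorr {X Y : Corresp.{u}} (r : Set Y.carrier → Set X.carrier → Prop) : X ⟶ Y :=
  show Set (Y.carrier × X.carrier) from {p | ∀ B, r B {p.2} → p.1 ∈ B}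

lemma imageMap_subset_iff {X Y : Corresp.{u}} (U : X ⟶ Y) (A : Set X.carrier)
    (B : Set Y.carrier) : imageMap U A ⊆ B ↔
      ∀ x ∈ A, ∀ y, (y, x) ∈ (show Set (Y.carrier × X.carrier) from U) → y ∈ B :=
  ⟨fun h x hx _ hy => h ⟨x, hx, hy⟩, fun h y ⟨x, hx, hy⟩ => h x hx y hy⟩

/-- The sets related to `B` form a principal ideal, and containment in its top element is tested on
points. -/
lemma IsLinked.iff_singleton {X Y : Type u} {r : Set Y → Set X → Prop} (h : IsLinked r)
    {B : Set Y} (hB : r B ∅) (A : Set X) : r B A ↔ ∀ x ∈ A, r B {x} := by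
  obtain ⟨y, hy⟩ := h.right B hB
  simp only [hy, Set.singleton_subset_iff]
  rfl

/-- The fibre of `relCorr r` over `x` is the intersection of all sets related to `{x}`. By left
linkedness these sets form a principal filter, so the intersection is its least member. -/
lemma IsLinked.iff_relCorr {X Y : Corresp.{u}} {r : Set Y.carrier → Set X.carrier → Prop}
    (h : IsLinked r) {x : X.carrier} (hx : r Set.univ {x}) (B : Set Y.carrier) :
    r B {x} ↔ ∀ y, (y, x) ∈ (show Set (Y.carrier × X.carrier) from relCorr r) → y ∈ B := by
  obtain ⟨s, hs⟩ := h.left _ hx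
  refine ⟨fun hB y hy => hy B hB, fun hB => (hs B).2 fun y hy => hB y fun B' hB' => ?_⟩
  exact (hs B').1 hB' hy

/-- Fullness supplies the side conditions `r B ∅` and `r univ {x}` of the two preceding lemmas at
every `B` and `x`, so `r` is determined by its values on singletons. -/
lemma IsLinked.iff_imageMap {X Y : Corresp.{u}} {r : Set Y.carrier → Set X.carrier → Prop}
    (h : IsLinked r) (hr : IsFull r) (B : Set Y.carrier) (A : Set X.carrier) :
    r B A ↔ imageMap (relCorr r) A ⊆ B := by
  rw [h.iff_singleton (h.mono (Set.empty_subset B) le_rfl hr.1), imageMap_subset_iff]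
  exact forall₂_congr fun x _ => h.iff_relCorr (h.mono le_rfl (Set.subset_univ _) hr.2) B

lemma isLinked_imageMap {X Y : Corresp.{u}} (U : X ⟶ Y) :
    IsLinked fun (B : Set Y.carrier) (A : Set X.carrier) => imageMap U A ⊆ B where
  mono hB hA h := ((imageMap_gc U).monotone_l hA).trans (h.trans hB)
  left A _ := ⟨imageMap U A, fun _ => Iff.rfl⟩
  right B _ := ⟨_, fun A => imageMap_gc U A B⟩

lemma isFull_imageMap {X Y : Corresp.{u}} (U : X ⟶ Y) :
    IsFull fun (B : Set Y.carrier) (A : Set X.carrier) => imageMap U A ⊆ B :=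
  ⟨by rintro y ⟨x, hx, -⟩; exact hx, Set.subset_univ _⟩

lemma relCorr_imageMap {X Y : Corresp.{u}} (U : X ⟶ Y) :
    relCorr (fun (B : Set Y.carrier) (A : Set X.carrier) => imageMap U A ⊆ B) = U := by
  refine Set.ext fun ⟨y, x⟩ => ?_
  refine ⟨fun h => ?_, fun h B hB => hB ⟨x, rfl, h⟩⟩
  -- The test set is the smallest possible one, `imageMap U {x}`.
  obtain ⟨x', rfl, h'⟩ := h _ subset_rfl
  exact h'

/-- A full relation that factors through the subsets of `Z` comes from a correspondence that
factors through `Z`. -/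
lemma relCorr_relComp {X Y Z : Corresp.{u}} {p : Set Y.carrier → Set Z.carrier → Prop}
    {q : Set Z.carrier → Set X.carrier → Prop} (hp : IsLinked p) (hq : IsLinked q)
    (h : IsFull (relComp p q)) : relCorr (relComp p q) = relCorr q ≫ relCorr p := by
  obtain ⟨⟨C₀, hp₀, hq₀⟩, C₁, hp₁, hq₁⟩ := h
  refine Set.ext fun ⟨y, x⟩ => ?_
  -- Neither `p` nor `q` need be full. The witnesses give only half of fullness for each, namely `q
  -- univ univ` and `p ∅ ∅`. The missing bound on `p` is needed only below the least `s` with `q s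
  -- {x}`, where `s ⊆ C₁` provides it.
  have hqx : q Set.univ {x} := hq.mono (Set.subset_univ _) (Set.subset_univ _) hq₁
  obtain ⟨s, hs⟩ := hq.left _ hqx
  have hsq : ∀ z, (z, x) ∈ (show Set (Z.carrier × X.carrier) from relCorr q) ↔ z ∈ s :=
    fun z => ⟨fun h => h s ((hs s).2 le_rfl), fun h B hB => (hs B).1 hB h⟩
  have hps : p Set.univ s :=
    hp.mono le_rfl ((hs C₁).1 (hq.mono le_rfl (Set.subset_univ _) hq₁)) hp₁
  have key : ∀ B, relComp p q B {x} ↔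
      ∀ z ∈ s, ∀ y, (y, z) ∈ (show Set (Y.carrier × Z.carrier) from relCorr p) → y ∈ B := by
    intro B
    have h₁ : relComp p q B {x} ↔ p B s :=
      ⟨fun ⟨C, hC, hC'⟩ => hp.mono le_rfl ((hs C).1 hC') hC, fun h => ⟨s, h, (hs s).2 le_rfl⟩⟩
    rw [h₁, hp.iff_singleton (hp.mono (Set.empty_subset B) (Set.empty_subset C₀) hp₀)]
    exact forall₂_congr fun z hz =>
      hp.iff_relCorr (hp.mono le_rfl (Set.singleton_subset_iff.2 hz) hps) B
  constructor
  · intro hy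
    -- Membership in `relCorr` is tested on the least set related to `{x}` by the composite, which
    -- is the union of the fibres of `relCorr p` over `s`.
    obtain ⟨z, hz, hyz⟩ := hy {y | ∃ z ∈ s, (y, z) ∈
      (show Set (Y.carrier × Z.carrier) from relCorr p)} ((key _).2 fun z hz y hy => ⟨z, hz, hy⟩)
    exact ⟨z, hyz, (hsq z).2 hz⟩
  · rintro ⟨z, hyz, hzx⟩ B hB
    exact (key B).1 hB z ((hsq z).1 hzx) y hyz

/-- A relation that is not full factors through a proper subset. -/
lemma IsLinked.exists_factorization {X : Type u} {r : Set X → Set X → Prop} (h : IsLinked r)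
    (h₀ : r Set.univ ∅) (hr : ¬ IsFull r) : ∃ (Z : Set X) (q : Set X → Set Z → Prop)
      (s : Set Z → Set X → Prop), Z ≠ Set.univ ∧ IsLinked q ∧ IsLinked s ∧ r = relComp q s := by
  by_cases hu : r Set.univ Set.univ
  · have he : ¬ r ∅ ∅ := fun he => hr ⟨he, hu⟩
    -- `x` is the least first entry occurring in `r`, and it is nonempty because `r ∅ ∅` fails.
    -- Since all first entries contain `x`, only their parts outside `x` carry information, so the
    -- complement of `x` serves as the intermediate set.
    obtain ⟨x, hx⟩ := h.left _ h₀
    have hrx : ∀ {B A}, r B A → x ⊆ B := fun hBA =>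
      (hx _).1 (h.mono le_rfl (Set.empty_subset _) hBA)
    refine ⟨xᶜ, fun B C => x ∪ (↑) '' C ⊆ B, fun C A => r (x ∪ (↑) '' C) A, ?_, ⟨?_, ?_, ?_⟩,
      ⟨?_, ?_, ?_⟩, ?_⟩
    · intro hZ
      exact he ((hx _).2 (Set.compl_univ_iff.1 hZ).subset)
    · intro B B' A A' hB hA hh
      exact (Set.union_subset_union_right x (Set.image_mono hA)).trans (hh.trans hB)
    · exact fun C _ => ⟨_, fun _ => Iff.rfl⟩
    · intro B hB
      refine ⟨(↑) ⁻¹' B, fun C => ?_⟩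
      rw [Set.union_subset_iff, and_iff_right (Set.union_subset_iff.1 hB).1, Set.image_subset_iff]
    · intro B B' A A' hB hA hh
      exact h.mono (Set.union_subset_union_right x (Set.image_mono hB)) hA hh
    · intro A hA
      obtain ⟨y, hy⟩ := h.left A (h.mono (Set.subset_univ _) le_rfl hA)
      refine ⟨(↑) ⁻¹' y, fun C => (hy _).trans ⟨?_, ?_⟩⟩
      · rintro hyC ⟨z, hz⟩ hzy
        rcases hyC hzy with h' | ⟨c, hc, h'⟩
        · exact absurd h' hz
        · rwa [← show c = ⟨z, hz⟩ from Subtype.ext h']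
      · intro hyC z hz
        by_cases hzx : z ∈ x
        · exact Or.inl hzx
        · exact Or.inr ⟨⟨z, hzx⟩, hyC hz, rfl⟩
    · exact fun C hC => h.right _ hC
    · ext B A
      refine ⟨fun hBA => ⟨(↑) ⁻¹' B, ?_, ?_⟩, fun ⟨C, hC, hCA⟩ => h.mono hC le_rfl hCA⟩
      · exact Set.union_subset (hrx hBA) (Set.image_subset_iff.2 le_rfl)
      · refine h.mono (fun b hb => ?_) le_rfl hBA
        by_cases hbx : b ∈ x
        · exact Or.inl hbx
        · exact Or.inr ⟨⟨b, hbx⟩, hb, rfl⟩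
  -- The dual case: `y` is the greatest second entry, it is proper because `r univ univ` fails, and
  -- all second entries are subsets of `y`.
  · obtain ⟨y, hy⟩ := h.right _ h₀
    have hry : ∀ {B A}, r B A → A ⊆ y := fun hBA =>
      (hy _).1 (h.mono (Set.subset_univ _) le_rfl hBA)
    have himg : ∀ {A : Set X}, A ⊆ y → A ⊆ (↑) '' ((↑) ⁻¹' A : Set y) :=
      fun hA a ha => ⟨⟨a, hA ha⟩, ha, rfl⟩
    refine ⟨y, fun B C => r B ((↑) '' C), fun C A => A ⊆ (↑) '' C, ?_, ⟨?_, ?_, ?_⟩,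
      ⟨?_, ?_, ?_⟩, ?_⟩
    · rintro hZ
      exact hu ((hy _).2 hZ.symm.subset)
    · exact fun hB hA hh => h.mono hB (Set.image_mono hA) hh
    · exact fun C hC => h.left _ hC
    · intro B hB
      obtain ⟨z, hz⟩ := h.right B (h.mono le_rfl (Set.empty_subset _) hB)
      exact ⟨(↑) ⁻¹' z, fun C => (hz _).trans Set.image_subset_iff⟩
    · exact fun hB hA hh => hA.trans (hh.trans (Set.image_mono hB))
    · intro A hA
      have hA' : A ⊆ y := hA.trans (by rintro _ ⟨z, -, rfl⟩; exact z.2)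
      refine ⟨(↑) ⁻¹' A, fun C => ⟨?_, fun hC => (himg hA').trans (Set.image_mono hC)⟩⟩
      intro hC z hz
      obtain ⟨c, hc, h'⟩ := hC hz
      rwa [← show c = z from Subtype.ext h']
    · exact fun C _ => ⟨_, fun _ => Iff.rfl⟩
    · ext B A
      refine ⟨fun hBA => ⟨(↑) ⁻¹' A, ?_, himg (hry hBA)⟩, fun ⟨C, hC, hCA⟩ =>
        h.mono le_rfl hCA hC⟩
      exact h.mono le_rfl (Set.image_subset_iff.2 le_rfl) hBA

/-! ### Birepresentable bisets over Boolean lattices -/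

section PowerBisets

variable {X Y Z : Corresp.{u}}

/-- The morphism of `powerCat X` given by an inclusion. -/
def powHom {A A' : Set X.carrier} (h : A ⊆ A') :
    (show (powerCat X).carrier from A) ⟶ (show (powerCat X).carrier from A') :=
  homOfLE (X := Set X.carrier) h

lemma subset_of_powHom {A A' : (powerCat X).carrier} (f : A ⟶ A') :
    (show Set X.carrier from A) ⊆ A' :=
  leOfHom (X := Set X.carrier) f

instance subsingleton_hom_powerCat {A A' : (powerCat X).carrier} : Subsingleton (A ⟶ A') :=
  inferInstanceAs (Subsingleton (ULift (PLift ((show Set X.carrier from A) ≤ A'))))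

/-- The values of a biset over Boolean lattices, indexed by sets. -/
abbrev PEl (P : Profunctor.{u} (powerCat Y).carrier (powerCat X).carrier) (B : Set Y.carrier)
    (A : Set X.carrier) : Type u :=
  El P (show (powerCat Y).carrier from B) (show (powerCat X).carrier from A)

/-- Transport of elements along inclusions. -/
def move (P : Profunctor.{u} (powerCat Y).carrier (powerCat X).carrier)
    {B B' : Set Y.carrier} {A A' : Set X.carrier} (hB : B ⊆ B') (hA : A' ⊆ A) (u : PEl P B A) :
    PEl P B' A' :=
  ract P (lact P (powHom hB) u) (powHom hA)

section
variable (P : Profunctor.{u} (powerCat Y).carrier (powerCat X).carrier)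

lemma move_refl {B : Set Y.carrier} {A : Set X.carrier} (hB : B ⊆ B) (hA : A ⊆ A)
    (u : PEl P B A) : move P hB hA u = u := by
  unfold move
  rw [show powHom hB = 𝟙 _ from Subsingleton.elim _ _,
    show powHom hA = 𝟙 _ from Subsingleton.elim _ _, lact_id, ract_id]

lemma move_move {B B' B'' : Set Y.carrier} {A A' A'' : Set X.carrier} (hB : B ⊆ B')
    (hA : A' ⊆ A) (hB' : B' ⊆ B'') (hA' : A'' ⊆ A') (u : PEl P B A) :
    move P hB' hA' (move P hB hA u) = move P (hB.trans hB') (hA'.trans hA) u := by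
  unfold move
  rw [lact_ract, ← ract_comp, ← lact_comp]
  congr 1

lemma lact_eq_move {B B' : (powerCat Y).carrier} {A : (powerCat X).carrier} (f : B ⟶ B')
    (u : El P B A) :
      lact P f u = move P (subset_of_powHom f) (subset_refl (α := Set X.carrier) A) u := by
  unfold move
  rw [show powHom (subset_refl (α := Set X.carrier) A) = 𝟙 _ from Subsingleton.elim _ _, ract_id]
  rfl

lemma ract_eq_move {B : (powerCat Y).carrier} {A A' : (powerCat X).carrier} (f : A' ⟶ A)
    (u : El P B A) :
      ract P u f = move P (subset_refl (α := Set Y.carrier) B) (subset_of_powHom f) u := by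
  unfold move
  rw [show powHom (subset_refl (α := Set Y.carrier) B) = 𝟙 _ from Subsingleton.elim _ _, lact_id]
  rfl

end

/-- Left representability in terms of minimal elements. -/
lemma exists_minimal {P : Profunctor.{u} (powerCat Y).carrier (powerCat X).carrier}
    (hP : IsBirepresentable P) {A : Set X.carrier} (t : PEl P Set.univ A) :
    ∃ (x : Set Y.carrier) (s : PEl P x A), ∀ (B : Set Y.carrier) (v : PEl P B A),
      move P (Set.subset_univ _) le_rfl v = t → ∃ h : x ⊆ B, v = move P h le_rfl s := by
  obtain ⟨I, x, g, hg⟩ := (isRepresentableSet_leftSet_iff P).1 hP.left A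
  obtain ⟨⟨i, f⟩, hf, hu⟩ := hg Set.univ t
  refine ⟨x i, g i, fun B v hv => ?_⟩
  obtain ⟨⟨j, f'⟩, rfl, -⟩ := hg B v
  -- The generator of `v` also generates the image `t` of `v`, so uniqueness identifies it with the
  -- generator of `t`.
  have := hu ⟨j, f' ≫ powHom (Set.subset_univ _)⟩
    ((lact_comp P f' (powHom (Set.subset_univ _)) (g j)).trans
      ((lact_eq_move P (powHom (Set.subset_univ _)) _).trans hv))
  cases this
  exact ⟨subset_of_powHom f', lact_eq_move P f' _⟩

/-- Right representability in terms of maximal elements. -/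
lemma exists_maximal {P : Profunctor.{u} (powerCat Y).carrier (powerCat X).carrier}
    (hP : IsBirepresentable P) {B : Set Y.carrier} (t : PEl P B ∅) :
    ∃ (y : Set X.carrier) (s : PEl P B y), ∀ (A : Set X.carrier) (v : PEl P B A),
      move P le_rfl (Set.empty_subset _) v = t → ∃ h : A ⊆ y, v = move P le_rfl h s := by
  obtain ⟨I, x, g, hg⟩ := (isRepresentableSet_rightSet_iff P).1 hP.right B
  obtain ⟨⟨i, f⟩, hf, hu⟩ := hg (∅ : Set X.carrier) t
  refine ⟨x i, g i, fun A v hv => ?_⟩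
  obtain ⟨⟨j, f'⟩, rfl, -⟩ := hg A v
  have := hu ⟨j, powHom (Set.empty_subset _) ≫ f'⟩
    ((ract_comp P (powHom (Set.empty_subset _)) f' (g j)).trans
      ((ract_eq_move P (powHom (Set.empty_subset _)) _).trans hv))
  cases this
  exact ⟨subset_of_powHom f', ract_eq_move P f' _⟩

/-- Elements with the same image over `univ` are transported from the same minimal element, along
the unique inclusion. -/
lemma move_left_injective {P : Profunctor.{u} (powerCat Y).carrier (powerCat X).carrier}
    (hP : IsBirepresentable P) {B B' : Set Y.carrier} {A : Set X.carrier} (hB : B ⊆ B') :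
    Function.Injective (move P hB (le_refl A)) := by
  intro u v huv
  obtain ⟨x, s, hs⟩ := exists_minimal hP (move P (Set.subset_univ _) le_rfl u)
  obtain ⟨_, h₁⟩ := hs B u rfl
  obtain ⟨_, h₂⟩ := hs B v (by
    have := congrArg (move P (Set.subset_univ _) le_rfl) huv
    rw [move_move, move_move] at this
    exact this.symm)
  rw [h₁, h₂]

lemma move_right_injective {P : Profunctor.{u} (powerCat Y).carrier (powerCat X).carrier}
    (hP : IsBirepresentable P) {B : Set Y.carrier} {A A' : Set X.carrier} (hA : A' ⊆ A) :
    Function.Injective (move P (le_refl B) hA) := by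
  intro u v huv
  obtain ⟨x, s, hs⟩ := exists_maximal hP (move P le_rfl (Set.empty_subset _) u)
  obtain ⟨_, h₁⟩ := hs A u rfl
  obtain ⟨_, h₂⟩ := hs A v (by
    have := congrArg (move P le_rfl (Set.empty_subset _)) huv
    rw [move_move, move_move] at this
    exact this.symm)
  rw [h₁, h₂]

lemma move_injective {P : Profunctor.{u} (powerCat Y).carrier (powerCat X).carrier}
    (hP : IsBirepresentable P) {B B' : Set Y.carrier} {A A' : Set X.carrier} (hB : B ⊆ B')
    (hA : A' ⊆ A) : Function.Injective (move P hB hA) := by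
  intro u v huv
  have h : ∀ w, move P hB hA w = move P le_rfl hA (move P hB le_rfl w) := fun w => by
    rw [move_move]
  rw [h, h] at huv
  exact move_left_injective hP hB (move_right_injective hP hA huv)

/-- The component to which an element belongs. -/
abbrev component (P : Profunctor.{u} (powerCat Y).carrier (powerCat X).carrier) {B : Set Y.carrier}
    {A : Set X.carrier} (u : PEl P B A) : PEl P Set.univ ∅ :=
  move P (Set.subset_univ _) (Set.empty_subset _) u

/-- The relation that describes the component `t` of a biset. -/
def componentRel (P : Profunctor.{u} (powerCat Y).carrier (powerCat X).carrier)
    (t : PEl P Set.univ ∅) (B : Set Y.carrier) (A : Set X.carrier) : Prop :=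
  ∃ u : PEl P B A, component P u = t

/-- Since transport is injective, the component `t` meets each `P(univ, A)` in at most one element.
A nonempty column of the component is therefore a single representable, and its representing set is
the least element of the column; rows are dual. -/
lemma isLinked_componentRel {P : Profunctor.{u} (powerCat Y).carrier (powerCat X).carrier}
    (hP : IsBirepresentable P) (t : PEl P Set.univ ∅) : IsLinked (componentRel P t) where
  mono := by
    rintro B B' A A' hB hA ⟨u, rfl⟩
    exact ⟨move P hB hA u, move_move P _ _ _ _ _⟩
  left := by
    rintro A ⟨u, hu⟩
    obtain ⟨x, s, hs⟩ := exists_minimal hP u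
    obtain ⟨_, h₁⟩ := hs _ u (move_refl _ _ _ _)
    refine ⟨x, fun B => ⟨?_, fun h => ⟨move P h le_rfl s, ?_⟩⟩⟩
    · rintro ⟨v, hv⟩
      refine (hs B v (move_injective hP le_rfl (Set.empty_subset _) ?_)).1
      rw [move_move]
      exact hv.trans hu.symm
    · rw [← hu, h₁, component, component, move_move, move_move]
  right := by
    rintro B ⟨u, hu⟩
    obtain ⟨x, s, hs⟩ := exists_maximal hP u
    obtain ⟨_, h₁⟩ := hs _ u (move_refl _ _ _ _)
    refine ⟨x, fun A => ⟨?_, fun h => ⟨move P le_rfl h s, ?_⟩⟩⟩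
    · rintro ⟨v, hv⟩
      refine (hs A v (move_injective hP (Set.subset_univ _) le_rfl ?_)).1
      rw [move_move]
      exact hv.trans hu.symm
    · rw [← hu, h₁, component, component, move_move, move_move]

/-! ### Isomorphisms -/

/-- Bisets with at most one element at each place are isomorphic if they have elements at the
same places. -/
lemma isIso_of_subsingleton {C D : FinCat.{u}} {P Q : Biset11 C D}
    (hP : ∀ x y, Subsingleton (El P.toProf x y)) (hQ : ∀ x y, Subsingleton (El Q.toProf x y))
    (h : ∀ x y, Nonempty (El P.toProf x y) ↔ Nonempty (El Q.toProf x y)) : P.IsIso Q := by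
  refine nonempty_iso_iff.2 ⟨fun x y => ⟨fun u => ((h x y).1 ⟨u⟩).some,
    fun v => ((h x y).2 ⟨v⟩).some, fun _ => (hP x y).elim _ _, fun _ => (hQ x y).elim _ _⟩,
    fun _ _ => (hQ _ _).elim _ _, fun _ _ => (hQ _ _).elim _ _⟩

/-- The disjoint union of the bisets given by a finite family of linked relations. -/
def relBiset {T : Type u} [Finite T] (r : T → Set Y.carrier → Set X.carrier → Prop)
    (hr : ∀ t, IsLinked (r t)) : Biset11 (powerCat Y) (powerCat X) where
  toProf := ofActions (C := (powerCat Y).carrier) (D := (powerCat X).carrier)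
    (fun B A => {t : T // r t B A})
    (fun f u => ⟨u.1, (hr u.1).mono (subset_of_powHom f) le_rfl u.2⟩)
    (fun u f => ⟨u.1, (hr u.1).mono le_rfl (subset_of_powHom f) u.2⟩)
    (fun _ => rfl) (fun _ => rfl) (fun _ _ _ => rfl) (fun _ _ _ => rfl) (fun _ _ _ => rfl)
  finite B A := inferInstanceAs (Finite {t : T // r t B A})
  birep :=
    { left := (isRepresentableSet_leftSet_iff _).2 fun A => by
        have hl : ∀ i : {t : T // r t Set.univ A}, ∃ x, ∀ B, r i.1 B A ↔ x ⊆ B :=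
          fun i => (hr i.1).left A i.2
        choose x hx using hl
        -- There is one generator for each relation whose column at `A` is nonempty; the other
        -- relations contribute nothing.
        refine ⟨{t : T // r t Set.univ A}, x, fun i => ⟨i.1, (hx i _).2 le_rfl⟩, ?_⟩
        rintro B ⟨t, ht⟩
        have ht' : r t Set.univ A := (hr t).mono (Set.subset_univ _) le_rfl ht
        refine ⟨⟨⟨t, ht'⟩, powHom ((hx ⟨t, ht'⟩ B).1 ht)⟩, rfl, ?_⟩
        rintro ⟨⟨t', h'⟩, f⟩ hf
        obtain rfl : t' = t := congrArg Subtype.val hf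
        exact congrArg (Sigma.mk _) ((subsingleton_hom_powerCat (A := x ⟨t', h'⟩) (A' := B)).elim _ _)
      right := (isRepresentableSet_rightSet_iff _).2 fun B => by
        have hl : ∀ i : {t : T // r t B ∅}, ∃ y, ∀ A, r i.1 B A ↔ A ⊆ y :=
          fun i => (hr i.1).right B i.2
        choose y hy using hl
        refine ⟨{t : T // r t B ∅}, y, fun i => ⟨i.1, (hy i _).2 le_rfl⟩, ?_⟩
        rintro A ⟨t, ht⟩
        have ht' : r t B ∅ := (hr t).mono le_rfl (Set.empty_subset _) ht
        refine ⟨⟨⟨t, ht'⟩, powHom ((hy ⟨t, ht'⟩ A).1 ht)⟩, rfl, ?_⟩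
        rintro ⟨⟨t', h'⟩, f⟩ hf
        obtain rfl : t' = t := congrArg Subtype.val hf
        exact congrArg (Sigma.mk _) ((subsingleton_hom_powerCat (A := A) (A' := y ⟨t', h'⟩)).elim _ _) }

/-- The biset given by one linked relation. -/
abbrev relBiset₁ (r : Set Y.carrier → Set X.carrier → Prop) (hr : IsLinked r) :
    Biset11 (powerCat Y) (powerCat X) :=
  relBiset (fun _ : PUnit.{u + 1} => r) fun _ => hr

lemma subsingleton_relBiset₁ {r : Set Y.carrier → Set X.carrier → Prop} (hr : IsLinked r)
    (B A) : Subsingleton (El (relBiset₁ r hr).toProf B A) :=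
  inferInstanceAs (Subsingleton {_t : PUnit.{u + 1} // r B A})

lemma nonempty_relBiset₁ {r : Set Y.carrier → Set X.carrier → Prop} (hr : IsLinked r)
    (B : Set Y.carrier) (A : Set X.carrier) :
    Nonempty (PEl (relBiset₁ r hr).toProf B A) ↔ r B A :=
  ⟨fun ⟨u⟩ => u.2, fun h => ⟨⟨⟨⟩, h⟩⟩⟩

/-- A birepresentable biset is the disjoint union of its components. -/
lemma isIso_relBiset (P : Biset11 (powerCat Y) (powerCat X)) :
    haveI := P.finite
    P.IsIso (relBiset (T := PEl P.toProf Set.univ ∅) (componentRel P.toProf)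
      (isLinked_componentRel P.birep)) := by
  refine nonempty_iso_iff.2 ⟨fun B A => Equiv.ofBijective
    (fun u => ⟨component P.toProf u, u, rfl⟩) ⟨fun u v huv => ?_, ?_⟩, ?_, ?_⟩
  · exact move_injective P.birep _ _ (congrArg Subtype.val huv)
  · rintro ⟨_, u, rfl⟩
    exact ⟨u, rfl⟩
  · intro B B' A f u
    refine Subtype.ext ?_
    change component P.toProf (lact P.toProf f u) = component P.toProf u
    rw [lact_eq_move]
    exact move_move _ _ _ _ _ _
  · intro B A A' u f
    refine Subtype.ext ?_
    change component P.toProf (ract P.toProf u f) = component P.toProf u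
    rw [ract_eq_move]
    exact move_move _ _ _ _ _ _

lemma relBiset_empty
    (r : PEmpty.{u + 1} → Set Y.carrier → Set X.carrier → Prop)
    (hr : ∀ t, IsLinked (r t)) :
    (relBiset r hr).IsIso (Biset11.empty (powerCat Y) (powerCat X)) :=
  isIso_of_subsingleton (fun _ _ => ⟨fun u => u.1.elim⟩) (fun _ _ => ⟨fun u => PEmpty.elim u⟩)
    fun _ _ => ⟨fun ⟨u⟩ => u.1.elim, fun ⟨u⟩ => PEmpty.elim u⟩

lemma relBiset_equiv {S T : Type u} [Finite S] [Finite T] (e : S ≃ T)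
    (r : T → Set Y.carrier → Set X.carrier → Prop) (hr : ∀ t, IsLinked (r t)) :
    (relBiset r hr).IsIso (relBiset (fun s => r (e s)) fun s => hr (e s)) :=
  nonempty_iso_iff.2 ⟨fun B A => (e.subtypeEquiv (p := fun s => r (e s) B A)
    (q := fun t => r t B A) fun _ => Iff.rfl).symm,
    fun _ _ => rfl, fun _ _ => rfl⟩

/-- Together with `relBiset_empty` and `relBiset_equiv`, this allows induction on a finite family of
relations. -/
lemma relBiset_option {T : Type u} [Finite T]
    (r : Option T → Set Y.carrier → Set X.carrier → Prop) (hr : ∀ t, IsLinked (r t)) :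
    (relBiset r hr).IsSum (relBiset₁ (r none) (hr none))
      (relBiset (fun t => r (some t)) fun t => hr (some t)) := by
  refine nonempty_iso_iff.2 ⟨fun B A => Equiv.symm ⟨Sum.elim (fun u => ⟨none, u.2⟩)
    (fun u => ⟨some u.1, u.2⟩), ?_, ?_, ?_⟩, ?_, ?_⟩
  · rintro ⟨_ | t, h⟩
    · exact Sum.inl ⟨⟨⟩, h⟩
    · exact Sum.inr ⟨t, h⟩
  · rintro (⟨⟨⟩, h⟩ | ⟨t, h⟩) <;> rfl
  · rintro ⟨_ | t, h⟩ <;> rfl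
  · rintro B B' A f ⟨_ | t, h⟩ <;> rfl
  · rintro B A A' ⟨_ | t, h⟩ f <;> rfl

/-! ### Components of composites -/

/-- An element of a composite is determined by the images of its factors in
`P (B, ∅)` and `Q (univ, A)`. -/
lemma compEl_mk_eq {P : Profunctor.{u} (powerCat Y).carrier (powerCat Z).carrier}
    {Q : Profunctor.{u} (powerCat Z).carrier (powerCat X).carrier}
    (hP : IsBirepresentable P) (hQ : IsBirepresentable Q) {B : Set Y.carrier} {A : Set X.carrier}
    {C₁ C₂ : Set Z.carrier} (u₁ : PEl P B C₁) (v₁ : PEl Q C₁ A) (u₂ : PEl P B C₂)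
    (v₂ : PEl Q C₂ A)
    (hu : move P le_rfl (Set.empty_subset _) u₁ = move P le_rfl (Set.empty_subset _) u₂)
    (hv : move Q (Set.subset_univ _) le_rfl v₁ = move Q (Set.subset_univ _) le_rfl v₂) :
    CompEl.mk P Q u₁ v₁ = CompEl.mk P Q u₂ v₂ := by
  obtain ⟨x, s, hs⟩ := exists_minimal hQ (move Q (Set.subset_univ _) le_rfl v₁)
  obtain ⟨h₁, rfl⟩ := hs C₁ v₁ rfl
  obtain ⟨h₂, rfl⟩ := hs C₂ v₂ hv.symm
  -- Both second factors come from the same minimal element `s`. Sliding the inclusion across the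
  -- composite makes `s` the second factor of both pairs, so only the first factors remain to be
  -- compared.
  have key : ∀ (C : Set Z.carrier) (h : x ⊆ C) (u : PEl P B C),
      CompEl.mk P Q u (move Q h le_rfl s) = CompEl.mk P Q (move P le_rfl h u) s := by
    intro C h u
    have := CompEl.sound P Q u (powHom h) s
    rw [lact_eq_move, ract_eq_move] at this
    exact this.symm
  rw [key, key]
  congr 1
  refine move_right_injective hP (Set.empty_subset _) ?_
  rw [move_move, move_move]
  exact hu

/-- For arbitrary subsingleton-valued bisets over posets, the composite can have several classes at
one place, because the possible intermediate objects need not be connected. Birepresentability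
excludes this. -/
lemma subsingleton_compBiset {P : Profunctor.{u} (powerCat Y).carrier (powerCat Z).carrier}
    {Q : Profunctor.{u} (powerCat Z).carrier (powerCat X).carrier}
    (hP : IsBirepresentable P) (hQ : IsBirepresentable Q)
    (hP' : ∀ x y, Subsingleton (El P x y)) (hQ' : ∀ x y, Subsingleton (El Q x y)) (B A) :
    Subsingleton (El (compBiset P Q) B A) := by
  refine ⟨CompEl.ind fun C₁ u₁ v₁ => CompEl.ind fun C₂ u₂ v₂ => ?_⟩
  exact compEl_mk_eq hP hQ u₁ v₁ u₂ v₂ ((hP' _ _).elim _ _) ((hQ' _ _).elim _ _)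

lemma relBiset₁_comp {p : Set Y.carrier → Set Z.carrier → Prop}
    {q : Set Z.carrier → Set X.carrier → Prop} (hp : IsLinked p) (hq : IsLinked q)
    (h : IsLinked (relComp p q)) :
    ((relBiset₁ p hp).comp (relBiset₁ q hq)).IsIso (relBiset₁ (relComp p q) h) := by
  refine isIso_of_subsingleton (subsingleton_compBiset (relBiset₁ p hp).birep
    (relBiset₁ q hq).birep (subsingleton_relBiset₁ hp) (subsingleton_relBiset₁ hq))
    (subsingleton_relBiset₁ h) fun B A => ⟨?_, ?_⟩
  · rintro ⟨t⟩
    induction t using CompEl.ind with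
    | h C u v => exact ⟨⟨⟨⟩, C, u.2, v.2⟩⟩
  · rintro ⟨⟨_, C, h₁, h₂⟩⟩
    exact ⟨CompEl.mk (relBiset₁ p hp).toProf (relBiset₁ q hq).toProf (y := C) ⟨⟨⟩, h₁⟩ ⟨⟨⟩, h₂⟩⟩

lemma ofFunctor_imageFunctor_isIso (U : X ⟶ Y) :
    (Biset11.ofFunctor (imageFunctor U) (imageFunctor_isLeftAdjoint U)).IsIso
      (relBiset₁ _ (isLinked_imageMap U)) :=
  isIso_of_subsingleton
    (fun B A => inferInstanceAs (Subsingleton ((imageFunctor U).obj A ⟶ B)))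
    (subsingleton_relBiset₁ _)
    fun _ A => ⟨fun ⟨f⟩ => ⟨⟨⟨⟩, subset_of_powHom (A := (imageFunctor U).obj A) f⟩⟩,
      fun ⟨f⟩ => ⟨powHom f.2⟩⟩

/-- The component of a composite is described by the composite of components of the factors. -/
lemma exists_componentRel_compBiset_eq {P : Profunctor.{u} (powerCat Y).carrier (powerCat Z).carrier}
    {Q : Profunctor.{u} (powerCat Z).carrier (powerCat X).carrier}
    (hP : IsBirepresentable P) (hQ : IsBirepresentable Q)
    (t : PEl (compBiset P Q) Set.univ ∅) :
    ∃ p q, componentRel (compBiset P Q) t = relComp (componentRel P p) (componentRel Q q) := by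
  induction t using CompEl.ind with
  | h C₀ u₀ v₀ =>
    refine ⟨component P u₀, component Q v₀, ?_⟩
    -- The pair of components of the two factors is unchanged when a morphism slides across the
    -- composite, so it is an invariant of the class.
    let f : PEl (compBiset P Q) Set.univ ∅ → PEl P Set.univ ∅ × PEl Q Set.univ ∅ :=
      CompEl.lift (fun u v => (component P u, component Q v)) fun u β v =>
        Prod.ext (by rw [ract_eq_move]; exact move_move _ _ _ _ _ _)
          (by rw [lact_eq_move]; exact (move_move _ _ _ _ _ _).symm)
    ext B A
    constructor
    · rintro ⟨s, hs⟩
      induction s using CompEl.ind with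
      | h C u v =>
        have h := congrArg f hs
        refine ⟨C, ⟨u, ?_⟩, ⟨v, ?_⟩⟩
        · refine Eq.trans ?_ (congrArg Prod.fst h)
          change _ = component P (lact P _ u)
          rw [lact_eq_move]
          exact (move_move _ _ _ _ _ _).symm
        · refine Eq.trans ?_ (congrArg Prod.snd h)
          change _ = component Q (ract Q v _)
          rw [ract_eq_move]
          exact (move_move _ _ _ _ _ _).symm
    · rintro ⟨C, ⟨u, hu⟩, ⟨v, hv⟩⟩
      refine ⟨CompEl.mk P Q u v, ?_⟩
      -- At `(univ, ∅)` a class is determined by the components of its two factors.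
      refine compEl_mk_eq hP hQ (lact P (powHom (Set.subset_univ B)) u)
        (ract Q v (powHom (Set.empty_subset A))) u₀ v₀ ?_ ?_
      · rw [lact_eq_move, move_move]
        exact hu
      · rw [ract_eq_move, move_move]
        exact hv

end PowerBisets

open scoped TensorProduct

/-! ### Functoriality of the passage from correspondences to bisets -/

section Functoriality

variable (R : Type w) [CommRing R] {X Y Z : Corresp.{u}}

lemma cls_eq_of_isIso {C D : FinCat.{u}} {P Q : Biset11 D C} (h : P.IsIso Q) :
    (B11.cls R P : (B11.mk C : B11.{w, u} R) ⟶ B11.mk D) = B11.cls R Q :=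
  congrArg (fun t => (1 : R) ⊗ₜ[ℤ] t) (A11.cls_iso h)

lemma cls_comp {C D E : FinCat.{u}} (P : Biset11 D C) (Q : Biset11 E D) :
    (B11.cls R P : (B11.mk C : B11.{w, u} R) ⟶ B11.mk D) ≫
      (B11.cls R Q : (B11.mk D : B11.{w, u} R) ⟶ B11.mk E) = B11.cls R (Q.comp P) :=
  (AR11.comp_tmul R 1 1 Q P).trans (by rw [one_mul]; rfl)

lemma imageMap_comp (V : X ⟶ Y) (U : Y ⟶ Z) (A : Set X.carrier) :
    imageMap (V ≫ U) A = imageMap U (imageMap V A) := by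
  ext z
  constructor
  · rintro ⟨x, hx, y, hzy, hyx⟩
    exact ⟨y, ⟨x, hx, hyx⟩, hzy⟩
  · rintro ⟨y, ⟨x, hx, hyx⟩, hzy⟩
    exact ⟨x, hx, y, hzy, hyx⟩

lemma relComp_imageMap (V : X ⟶ Y) (U : Y ⟶ Z) :
    relComp (fun (C : Set Z.carrier) (B : Set Y.carrier) => imageMap U B ⊆ C)
      (fun (B : Set Y.carrier) (A : Set X.carrier) => imageMap V A ⊆ B) =
    fun C A => imageMap (V ≫ U) A ⊆ C := by
  ext C A
  rw [imageMap_comp]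
  exact ⟨fun ⟨B, hB, hA⟩ => ((imageMap_gc U).monotone_l hA).trans hB,
    fun h => ⟨_, h, subset_rfl⟩⟩

lemma correspMap_eq (U : X ⟶ Y) :
    correspMap R U = B11.cls R (relBiset₁ _ (isLinked_imageMap U)) :=
  cls_eq_of_isIso R (ofFunctor_imageFunctor_isIso U)

lemma cls_relBiset₁_congr {p q : Set Y.carrier → Set X.carrier → Prop} (h : p = q)
    (hp : IsLinked p) (hq : IsLinked q) :
    (B11.cls R (relBiset₁ p hp) : (B11.mk (powerCat X) : B11.{w, u} R) ⟶ B11.mk (powerCat Y)) =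
      B11.cls R (relBiset₁ q hq) := by
  subst h
  rfl

lemma correspMap_id (X : Corresp.{u}) :
    correspMap R (𝟙 X) = 𝟙 (B11.mk (powerCat X) : B11.{w, u} R) := by
  rw [correspMap_eq]
  refine cls_eq_of_isIso R (isIso_of_subsingleton (Q := Biset11.id (powerCat X))
    (subsingleton_relBiset₁ _) (fun B A => inferInstanceAs (Subsingleton (A ⟶ B))) fun B A => ?_)
  have h : imageMap (𝟙 X) A = A := by
    ext x
    exact ⟨fun ⟨y, hy, (hxy : x = y)⟩ => hxy ▸ hy, fun hx => ⟨x, hx, rfl⟩⟩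
  refine (nonempty_relBiset₁ _ B A).trans ?_
  rw [h]
  exact ⟨fun h => ⟨powHom h⟩, fun ⟨f⟩ => subset_of_powHom f⟩

lemma correspMap_comp (V : X ⟶ Y) (U : Y ⟶ Z) :
    correspMap R (V ≫ U) = (correspMap R V : (B11.mk _ : B11.{w, u} R) ⟶ _) ≫ correspMap R U := by
  rw [correspMap_eq, correspMap_eq, correspMap_eq, cls_comp]
  have h : IsLinked (relComp (fun (C : Set Z.carrier) (B : Set Y.carrier) => imageMap U B ⊆ C)
      (fun (B : Set Y.carrier) (A : Set X.carrier) => imageMap V A ⊆ B)) :=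
    relComp_imageMap V U ▸ isLinked_imageMap (V ≫ U)
  rw [cls_eq_of_isIso R (relBiset₁_comp (isLinked_imageMap U) (isLinked_imageMap V) h)]
  exact cls_relBiset₁_congr R (relComp_imageMap V U).symm _ _

/-- The linear extension of `correspMap` to endomorphism algebras. -/
noncomputable def correspLinearMap (X : Corresp.{u}) :
    End (Free.of R X) →ₗ[R] End (B11.mk (powerCat X) : B11.{w, u} R) :=
  Finsupp.linearCombination R (α := (X ⟶ X))
    (M := End (B11.mk (powerCat X) : B11.{w, u} R)) fun U => correspMap R U

lemma correspLinearMap_correspEnd (U : X ⟶ X) :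
    correspLinearMap R X (correspEnd R U) = correspMap R U :=
  (Finsupp.linearCombination_single R 1 U).trans (one_smul R _)

lemma correspLinearMap_mul (a b : End (Free.of R X)) :
    correspLinearMap R X (a * b) = correspLinearMap R X a * correspLinearMap R X b := by
  induction a using correspEnd_induction with
  | h0 => simp
  | hadd a a' ha ha' => rw [add_mul, map_add, map_add, ha, ha', add_mul]
  | hsmul r U =>
    induction b using correspEnd_induction with
    | h0 => simp
    | hadd b b' hb hb' => rw [mul_add, map_add, map_add, hb, hb', mul_add]
    | hsmul s V =>
      simp only [smul_mul_assoc, mul_smul_comm, map_smul, correspEnd_mul,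
        correspLinearMap_correspEnd, correspMap_comp]
      rfl

/-- `correspLinearMap` as a homomorphism of algebras. -/
noncomputable def correspAlgHom (X : Corresp.{u}) :
    End (Free.of R X) →ₐ[R] End (B11.mk (powerCat X) : B11.{w, u} R) :=
  AlgHom.ofLinearMap (correspLinearMap R X)
    ((correspLinearMap_correspEnd R (𝟙 X)).trans (correspMap_id R X)) (correspLinearMap_mul R)

lemma correspAlgHom_correspEnd (U : X ⟶ X) :
    correspAlgHom R X (correspEnd R U) = correspMap R U :=
  correspLinearMap_correspEnd R U

end Functoriality

/-! ### The linear retraction onto the essential algebra of correspondences -/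

section Retraction

variable (R : Type w) [CommRing R] {X Y Z : Corresp.{u}}

open Classical in
/-- The class of the correspondence of a full relation; zero for the other relations. -/
noncomputable def relClass (r : Set X.carrier → Set X.carrier → Prop) : EssCorresp R X :=
  if IsFull r then Ideal.Quotient.mk (inessCorresp R X) (correspEnd R (relCorr r)) else 0

/-- The sum of the classes of the components of a biset. -/
noncomputable def componentSum (P : Biset11 (powerCat X) (powerCat X)) : EssCorresp R X :=
  ∑ᶠ t : PEl P.toProf Set.univ ∅, relClass R (componentRel P.toProf t)

/-- An isomorphism commutes with transport to `(univ, ∅)`, so it matches components and preserves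
their relations. -/
lemma exists_equiv_componentRel {P Q : Profunctor.{u} (powerCat Y).carrier (powerCat X).carrier}
    (h : Nonempty (P ≅ Q)) : ∃ e : PEl P Set.univ ∅ ≃ PEl Q Set.univ ∅,
      ∀ t, componentRel Q (e t) = componentRel P t := by
  obtain ⟨e, hl, hr⟩ := nonempty_iso_iff.1 h
  refine ⟨e _ _, fun t => ?_⟩
  have key : ∀ (B : Set Y.carrier) (A : Set X.carrier) (u : PEl P B A),
      component Q (e _ _ u) = e _ _ (component P u) := fun B A u =>
    ((hr _ _).trans (congrArg (fun v => ract Q v _) (hl _ _))).symm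
  ext B A
  constructor
  · rintro ⟨v, hv⟩
    obtain ⟨u, rfl⟩ := (e _ _).surjective v
    exact ⟨u, (e _ _).injective ((key _ _ u).symm.trans hv)⟩
  · rintro ⟨u, rfl⟩
    exact ⟨e _ _ u, key _ _ u⟩

lemma componentRel_sumBiset_inl (P Q : Profunctor.{u} (powerCat Y).carrier (powerCat X).carrier)
    (t : PEl P Set.univ ∅) :
    componentRel (sumBiset P Q) (Sum.inl t : El P _ _ ⊕ El Q _ _) = componentRel P t := by
  ext B A
  constructor
  · rintro ⟨u | u, hu⟩
    · exact ⟨u, Sum.inl_injective (hu :)⟩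
    · exact (Sum.inr_ne_inl (hu :)).elim
  · rintro ⟨u, rfl⟩
    exact ⟨(Sum.inl u : El P _ _ ⊕ El Q _ _), rfl⟩

lemma componentRel_sumBiset_inr (P Q : Profunctor.{u} (powerCat Y).carrier (powerCat X).carrier)
    (t : PEl Q Set.univ ∅) :
    componentRel (sumBiset P Q) (Sum.inr t : El P _ _ ⊕ El Q _ _) = componentRel Q t := by
  ext B A
  constructor
  · rintro ⟨u | u, hu⟩
    · exact (Sum.inl_ne_inr (hu :)).elim
    · exact ⟨u, Sum.inr_injective (hu :)⟩
  · rintro ⟨u, rfl⟩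
    exact ⟨(Sum.inr u : El P _ _ ⊕ El Q _ _), rfl⟩

/-- The components of a disjoint union are those of its summands. This lets `componentSum` descend
to the Grothendieck group. -/
lemma componentSum_add {P P₁ P₂ : Biset11 (powerCat X) (powerCat X)} (h : P.IsSum P₁ P₂) :
    componentSum R P = componentSum R P₁ + componentSum R P₂ := by
  obtain ⟨e, he⟩ := exists_equiv_componentRel h
  -- Finiteness of the values makes each `finsum` an honest finite sum, so that it splits over the
  -- two summands.
  have := P₁.finite
  have := P₂.finite
  have := Fintype.ofFinite (PEl P₁.toProf Set.univ ∅)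
  have := Fintype.ofFinite (PEl P₂.toProf Set.univ ∅)
  let e' : PEl P.toProf Set.univ ∅ ≃ PEl P₁.toProf Set.univ ∅ ⊕ PEl P₂.toProf Set.univ ∅ := e
  have h₁ : componentSum R P = ∑ᶠ t : PEl P₁.toProf Set.univ ∅ ⊕ PEl P₂.toProf Set.univ ∅,
      relClass R (componentRel (sumBiset P₁.toProf P₂.toProf) t) := by
    rw [← finsum_comp_equiv e']
    exact finsum_congr fun t => congrArg (relClass R) (he t).symm
  rw [h₁, componentSum, componentSum, finsum_eq_sum_of_fintype, finsum_eq_sum_of_fintype,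
    finsum_eq_sum_of_fintype, Fintype.sum_sum_type]
  congr 1
  · exact Finset.sum_congr rfl fun t _ => congrArg (relClass R) (componentRel_sumBiset_inl _ _ t)
  · exact Finset.sum_congr rfl fun t _ => congrArg (relClass R) (componentRel_sumBiset_inr _ _ t)

/-- The linear extension of `componentSum`. -/
noncomputable def componentMap (X : Corresp.{u}) :
    End (B11.mk (powerCat X) : B11.{w, u} R) →ₗ[R] EssCorresp R X :=
  LinearMap.liftBaseChange R
    (A11.lift (C := powerCat X) (D := powerCat X) (componentSum R)
      (componentSum_add R)).toIntLinearMap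

lemma componentMap_bisetEnd (P : Biset11 (powerCat X) (powerCat X)) :
    componentMap R X (bisetEnd R P) = componentSum R P :=
  (LinearMap.liftBaseChange_tmul R _ _ _).trans
    ((one_smul R _).trans (A11.lift_cls _ (componentSum_add R) P))

lemma componentSum_relBiset₁ {r : Set X.carrier → Set X.carrier → Prop} (hr : IsLinked r)
    (h₀ : r Set.univ ∅) : componentSum R (relBiset₁ r hr) = relClass R r := by
  have key : ∀ t, componentRel (relBiset₁ r hr).toProf t = r := by
    intro t
    ext B A
    refine ⟨fun ⟨u, _⟩ => u.2, fun h => ⟨⟨⟨⟩, h⟩, ?_⟩⟩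
    exact (subsingleton_relBiset₁ hr (Set.univ : Set X.carrier) (∅ : Set X.carrier)).elim _ _
  have := subsingleton_relBiset₁ hr (Set.univ : Set X.carrier) (∅ : Set X.carrier)
  rw [componentSum, finsum_congr fun t => congrArg (relClass R) (key t)]
  exact finsum_eq_single _ ⟨⟨⟩, h₀⟩ fun t ht => (ht (this.elim _ _)).elim

lemma componentMap_correspMap (U : X ⟶ X) :
    componentMap R X (correspMap R U) = Ideal.Quotient.mk (inessCorresp R X) (correspEnd R U) := by
  have h : correspMap R U = bisetEnd R (relBiset₁ _ (isLinked_imageMap U)) := correspMap_eq R U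
  rw [h, componentMap_bisetEnd, componentSum_relBiset₁ R _ (Set.subset_univ _), relClass,
    if_pos (isFull_imageMap U), relCorr_imageMap]

/-- This is the retraction identity. Linearity of `componentMap` is enough for injectivity, so its
multiplicativity plays no role. -/
lemma componentMap_correspAlgHom (a : End (Free.of R X)) :
    componentMap R X (correspAlgHom R X a) = Ideal.Quotient.mk (inessCorresp R X) a := by
  induction a using correspEnd_induction with
  | h0 => simp
  | hadd a b ha hb => rw [map_add, map_add, ha, hb]; rfl
  | hsmul r U =>
    rw [map_smul, map_smul, correspAlgHom_correspEnd, componentMap_correspMap]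
    rfl

/-- The sum vanishes term by term: a component of a composite through `2^Z` is either not full, with
class zero by definition, or full, in which case `relCorr_relComp` factors its correspondence
through `Z`. -/
lemma componentMap_eq_zero_of_mem {a : End (B11.mk (powerCat X) : B11.{w, u} R)}
    (ha : a ∈ inessBiset R X) : componentMap R X a = 0 := by
  change a ∈ Submodule.span R (inessBisetSet R X) at ha
  suffices h : Submodule.span R (inessBisetSet R X) ≤ LinearMap.ker (componentMap R X) from h ha
  rw [Submodule.span_le]
  rintro _ ⟨Z, hZ, Q, S, rfl⟩
  change componentMap R X _ = 0
  rw [componentMap_bisetEnd]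
  refine finsum_eq_zero_of_forall_eq_zero fun t => ?_
  obtain ⟨q, s, h⟩ := exists_componentRel_compBiset_eq Q.birep S.birep t
  change relClass R (componentRel (compBiset Q.toProf S.toProf) t) = 0
  rw [relClass, h]
  split_ifs with hf
  · rw [relCorr_relComp (isLinked_componentRel Q.birep q) (isLinked_componentRel S.birep s) hf,
      Ideal.Quotient.eq_zero_iff_mem]
    exact Submodule.subset_span ⟨Z, hZ, _, _, rfl⟩
  · rfl

end Retraction

/-! ### The isomorphism of essential algebras -/

section Main

variable (R : Type w) [CommRing R] {X : Corresp.{u}}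

lemma correspAlgHom_mem {a : End (Free.of R X)} (ha : a ∈ inessCorresp R X) :
    correspAlgHom R X a ∈ inessBiset R X := by
  change a ∈ Submodule.span R (inessCorrespSet R X) at ha
  change _ ∈ Submodule.span R (inessBisetSet R X)
  suffices h : Submodule.span R (inessCorrespSet R X) ≤
    (Submodule.span R (inessBisetSet R X)).comap (correspAlgHom R X).toLinearMap from h ha
  rw [Submodule.span_le]
  rintro _ ⟨Z, hZ, W, V, rfl⟩
  refine Submodule.subset_span ⟨Z, hZ, relBiset₁ _ (isLinked_imageMap V),
    relBiset₁ _ (isLinked_imageMap W), ?_⟩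
  refine (correspAlgHom_correspEnd R (W ≫ V)).trans ?_
  rw [correspMap_comp, correspMap_eq, correspMap_eq, cls_comp]
  rfl

/-- The homomorphism of essential algebras induced by `correspAlgHom`. -/
noncomputable def essAlgHom (X : Corresp.{u}) : EssCorresp R X →ₐ[R] EssBiset R X :=
  Ideal.quotientMapₐ (inessBiset R X) (correspAlgHom R X) fun _ ha => correspAlgHom_mem R ha

lemma essAlgHom_mk (a : End (Free.of R X)) :
    essAlgHom R X (Ideal.Quotient.mk _ a) = Ideal.Quotient.mk _ (correspAlgHom R X a) := rfl

/-- Since `componentMap` vanishes on the inessential ideal, it recovers the class of `a` from the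
class of its image. -/
lemma essAlgHom_injective (X : Corresp.{u}) : Function.Injective (essAlgHom R X) := by
  refine (injective_iff_map_eq_zero _).2 fun t ht => ?_
  obtain ⟨a, rfl⟩ := Ideal.Quotient.mk_surjective t
  rw [essAlgHom_mk, Ideal.Quotient.eq_zero_iff_mem] at ht
  rw [← componentMap_correspAlgHom, componentMap_eq_zero_of_mem R ht]

/-- A full relation comes from its correspondence, a nonempty relation that is not full is
inessential, and an empty relation gives the empty biset, whose class is zero. -/
lemma mk_relBiset₁_mem_range {r : Set X.carrier → Set X.carrier → Prop} (hr : IsLinked r) :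
    Ideal.Quotient.mk (inessBiset R X) (bisetEnd R (relBiset₁ r hr)) ∈
      (essAlgHom R X).range := by
  by_cases h₀ : r Set.univ ∅
  · by_cases hf : IsFull r
    · refine ⟨Ideal.Quotient.mk _ (correspEnd R (relCorr r)), ?_⟩
      refine (essAlgHom_mk R _).trans (congrArg _ ?_)
      rw [correspAlgHom_correspEnd, correspMap_eq]
      refine cls_relBiset₁_congr R ?_ _ _
      ext B A
      exact (hr.iff_imageMap hf B A).symm
    · obtain ⟨Z, q, s, hZ, hq, hs, rfl⟩ := hr.exists_factorization h₀ hf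
      have h : Ideal.Quotient.mk (inessBiset R X) (bisetEnd R (relBiset₁ (relComp q s) hr)) = 0 := by
        rw [Ideal.Quotient.eq_zero_iff_mem]
        refine Submodule.subset_span ⟨⟨Z⟩, ?_, relBiset₁ q hq, relBiset₁ s hs, ?_⟩
        · exact (Set.ncard_lt_card hZ :)
        · exact (cls_eq_of_isIso R (relBiset₁_comp (Z := ⟨Z⟩) hq hs hr)).symm
      rw [h]
      exact zero_mem _
  · have h : (relBiset₁ r hr).IsIso (Biset11.empty (powerCat X) (powerCat X)) :=
      isIso_of_subsingleton (subsingleton_relBiset₁ hr) (fun _ _ => ⟨fun u => PEmpty.elim u⟩)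
        fun B A => ⟨fun ⟨u⟩ => (h₀ (hr.mono (Set.subset_univ _) (Set.empty_subset _) u.2)).elim,
          fun ⟨u⟩ => PEmpty.elim u⟩
    rw [bisetEnd_iso h, bisetEnd, B11.cls, AR11.cls, A11.cls_empty, TensorProduct.tmul_zero,
      map_zero]
    exact zero_mem _

lemma mk_relBiset_mem_range (T : Type u) [Finite T] :
    ∀ (r : T → Set X.carrier → Set X.carrier → Prop) (hr : ∀ t, IsLinked (r t)),
      Ideal.Quotient.mk (inessBiset R X) (bisetEnd R (relBiset r hr)) ∈
        (essAlgHom R X).range := by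
  -- The motive quantifies over the `Finite` instance because `relBiset` depends on it.
  refine Finite.induction_empty_option (P := fun T => ∀ [Finite T]
    (r : T → Set X.carrier → Set X.carrier → Prop) (hr : ∀ t, IsLinked (r t)),
      Ideal.Quotient.mk (inessBiset R X) (bisetEnd R (relBiset r hr)) ∈
        (essAlgHom R X).range) ?_ ?_ ?_ T
  · intro S T e ih _ r hr
    have := Finite.of_equiv T e.symm
    rw [bisetEnd_iso (relBiset_equiv e r hr)]
    exact ih _ _
  · intro _ r hr
    rw [bisetEnd_iso (relBiset_empty r hr), bisetEnd, B11.cls, AR11.cls, A11.cls_empty,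
      TensorProduct.tmul_zero, map_zero]
    exact zero_mem _
  · intro T _ ih _ r hr
    have h : bisetEnd R (relBiset r hr) = bisetEnd R (relBiset₁ (r none) (hr none)) +
        bisetEnd R (relBiset (fun t => r (some t)) fun t => hr (some t)) :=
      (congrArg (fun t => (1 : R) ⊗ₜ[ℤ] t) (A11.cls_sum (relBiset_option r hr))).trans
        (TensorProduct.tmul_add _ _ _)
    rw [h, map_add]
    exact add_mem (mk_relBiset₁_mem_range R _) (ih _ _)

/-- Up to isomorphism every biset is a finite disjoint union of linked relations, and the range is a
subalgebra, so one relation at a time suffices. -/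
lemma essAlgHom_surjective (X : Corresp.{u}) : Function.Surjective (essAlgHom R X) := by
  intro t
  obtain ⟨a, rfl⟩ := Ideal.Quotient.mk_surjective t
  change _ ∈ (essAlgHom R X).range
  induction a using bisetEnd_induction with
  | h0 => rw [map_zero]; exact zero_mem _
  | hadd a b ha hb => rw [map_add]; exact add_mem ha hb
  | hsmul r P =>
    have := P.finite
    have h : Ideal.Quotient.mk (inessBiset R X) (r • bisetEnd R P) =
        r • Ideal.Quotient.mk (inessBiset R X) (bisetEnd R P) := rfl
    rw [h, bisetEnd_iso (isIso_relBiset P)]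
    exact Subalgebra.smul_mem _ (mk_relBiset_mem_range R _ _ _) r

/-- The essential algebras of `X` and of `2^X` are isomorphic. -/
noncomputable def essAlgEquiv (X : Corresp.{u}) : EssCorresp R X ≃ₐ[R] EssBiset R X :=
  AlgEquiv.ofBijective (essAlgHom R X) ⟨essAlgHom_injective R X, essAlgHom_surjective R X⟩

end Main

end BisetCorr

theorem mainTheorem5 (R : Type w) [CommRing R] :
    ∃ (map_id : ∀ X : Corresp.{u},
        correspMap R (𝟙 X) = 𝟙 (B11.mk (powerCat X) : B11.{w, u} R))
      (map_comp : ∀ {X Y Z : Corresp.{u}} (V : X ⟶ Y) (U : Y ⟶ Z),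
        correspMap R (V ≫ U) = correspMap R V ≫ correspMap R U),
      let Φ : Corresp.{u} ⥤ B11.{w, u} R :=
        { obj := fun X => B11.mk (powerCat X)
          map := fun U => correspMap R U
          map_id := map_id
          map_comp := map_comp }
      ∀ X : Corresp.{u}, ∃ e : EssCorresp R X ≃ₐ[R] EssBiset R X,
        ∀ U : X ⟶ X,
          e (Ideal.Quotient.mk (inessCorresp R X) (correspEnd R U)) =
            Ideal.Quotient.mk (inessBiset R X) (Φ.map U) := by
  refine ⟨correspMap_id R, correspMap_comp R, fun X => ⟨essAlgEquiv R X, fun U => ?_⟩⟩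
  exact congrArg (Ideal.Quotient.mk (inessBiset R X)) (correspAlgHom_correspEnd R U)
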